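/- A signature consists of finitely many predicate symbols (with arities) and finitely many, but at least one, constant symbols; structures have non-empty domains. A homomorphism between $\tau$-structures preserves all relations of $\tau$ (in the forward direction) and all constants. For a class $\mathcal C$ of $\tau$-structures, its homomorphism closure $\mathcal C^{\to}$ is the class of all $\tau$-structures into which some member of $\mathcal C$ has a homomorphism, and $\mathcal C^{\to}_{\mathrm{fin}}$ is the class of all finite structures in $\mathcal C^{\to}$. We write $\mathrm{Mod}(\Phi)$ and $\mathrm{Mod}_{\mathrm{fin}}(\Phi)$ for the classes of models and of finite models of a sentence $\Phi$ (over its signature $\tau$). A logic $\mathbb L$ assigns to each signature $\tau$ a set of $\tau$-sentences (finite strings) and a satisfaction relation between $\tau$-structures and $\tau$-sentences, such that every $\sigma$-sentence is also a $\tau$-sentence if $\sigma\subseteq\tau$, its truth in a $\tau$-structure is its truth in the $\sigma$-reduct, and satisfaction is invariant under isomorphism. $\mathbb L$ is non-degenerate if it has an unsatisfiable sentence. $\mathbb L$ has a decidable model checking problem if there is an algorithm that, given a signature $\tau$, a $\tau$-sentence $\Psi$ of $\mathbb L$ and a finite $\tau$-structure $\mathfrak A$, decides whether $\mathfrak A$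 satisfies $\Psi$. **Theorem.** Let $\mathbb L$ be a non-degenerate logic with a decidable model checking problem. Then both of the following problems are undecidable. Given a signature $\tau$ and a $\tau$-sentence $\Phi$ of first-order logic with equality: 1. is there a $\tau$-sentence $\Psi$ of $\mathbb L$ with $\mathrm{Mod}(\Psi)=\mathrm{Mod}(\Phi)^{\to}$? 2. is there a $\tau$-sentence $\Psi$ of $\mathbb L$ with $\mathrm{Mod}_{\mathrm{fin}}(\Psi)=\mathrm{Mod}_{\mathrm{fin}}(\Phi)^{\to}_{\mathrm{fin}}$? -/

import Mathlib

open FirstOrder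

universe u

namespace HomClosure

/-! ### Signatures and structures -/

/-- A signature: finitely many constant symbols (at least one) and finitely many predicate
symbols, all taken from a fixed countable supply. A predicate symbol is a pair `(P, k)` of a
name `P` and an arity `k`. -/
@[ext]
structure Signature where
  consts : Finset ℕ
  preds : Finset (ℕ × ℕ)
  consts_nonempty : consts.Nonempty

namespace Signature

/-- The function symbols of a signature: only constants. -/
inductive Fn (τ : Signature) : ℕ → Type
  | const (c : ℕ) (hc : c ∈ τ.consts) : Fn τ 0

/-- The predicate symbols of arity `k` of a signature. -/
def Rel (τ : Signature) (k : ℕ) : Type := {P : ℕ // (P, k) ∈ τ.preds}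

/-- The first-order language of a signature. -/
def lang (τ : Signature) : Language := ⟨τ.Fn, τ.Rel⟩

/-- Inclusion of signatures. -/
instance : LE Signature := ⟨fun σ τ => σ.consts ⊆ τ.consts ∧ σ.preds ⊆ τ.preds⟩

/-- The language map induced by an inclusion of signatures. -/
def incl {σ τ : Signature} (h : σ ≤ τ) : σ.lang →ᴸ τ.lang where
  onFunction := fun _ f =>
    match f with
    | .const c hc => Fn.const c (h.1 hc)
  onRelation := fun _ R => ⟨R.1, h.2 R.2⟩

end Signature

/-- `τ`-structures. The domain is automatically non-empty, as `τ` has a constant. -/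
abbrev Str (τ : Signature) : Type (u + 1) := CategoryTheory.Bundled.{u} τ.lang.Structure

/-- The interpretation of a constant symbol. -/
def Str.const {τ : Signature} (A : Str.{u} τ) (c : ℕ) (hc : c ∈ τ.consts) : A :=
  Language.Structure.funMap (L := τ.lang) (n := 0) (Signature.Fn.const c hc) Fin.elim0

/-- The interpretation of a predicate symbol. -/
def Str.pred {τ : Signature} (A : Str.{u} τ) (P k : ℕ) (hP : (P, k) ∈ τ.preds)
    (a : Fin k → A) : Prop :=
  Language.Structure.RelMap (L := τ.lang) (n := k) ⟨P, hP⟩ a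

/-- The `σ`-reduct of a `τ`-structure, for `σ ⊆ τ`. -/
def Str.reduct {σ τ : Signature} (h : σ ≤ τ) (A : Str.{u} τ) : Str.{u} σ :=
  ⟨A, (Signature.incl h).reduct A⟩

/-- The finite members of a class of structures. -/
def finPart {τ : Signature} (C : Set (Str.{u} τ)) : Set (Str.{u} τ) := {A | A ∈ C ∧ Finite A}

/-- The homomorphism closure of a class of structures. -/
def homCl {τ : Signature} (C : Set (Str.{u} τ)) : Set (Str.{u} τ) :=
  {B | ∃ A ∈ C, Nonempty (A →[τ.lang] B)}

/-- The finite homomorphism closure: the finite members of the homomorphism closure. -/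
def homClFin {τ : Signature} (C : Set (Str.{u} τ)) : Set (Str.{u} τ) := finPart (homCl C)

/-- The class of models of a first-order sentence (with equality). -/
def foModels {τ : Signature} (Φ : τ.lang.Sentence) : Set (Str.{u} τ) := {A | A ⊨ Φ}

/-! ### Logics -/

/-- A logic: it assigns to every signature `τ` its set of `τ`-sentences, which are finite strings
and are identified with natural numbers, and says which `τ`-structures satisfy which
`τ`-sentences (the value of `Sat` on non-sentences is irrelevant). Sentences over a signature are
sentences over every larger one, truth is invariant under isomorphism, and the truth of a
`σ`-sentence depends only on the `σ`-reduct. -/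
structure Logic where
  Sentence : Signature → Set ℕ
  Sat : {τ : Signature} → Str.{u} τ → ℕ → Prop
  sentence_mono : ∀ {σ τ : Signature}, σ ≤ τ → Sentence σ ⊆ Sentence τ
  sat_iso : ∀ {τ : Signature} (A B : Str.{u} τ) (ψ : ℕ), ψ ∈ Sentence τ →
    Nonempty (A ≃[τ.lang] B) → (Sat A ψ ↔ Sat B ψ)
  sat_reduct : ∀ {σ τ : Signature} (h : σ ≤ τ) (A : Str.{u} τ) (ψ : ℕ), ψ ∈ Sentence σ →
    (Sat A ψ ↔ Sat (A.reduct h) ψ)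

/-- The class of `τ`-structures that are models of a sentence of a logic. -/
def Logic.models (L : Logic.{u}) (τ : Signature) (ψ : ℕ) : Set (Str.{u} τ) := {A | L.Sat A ψ}

/-- A logic is non-degenerate if it has an unsatisfiable sentence. -/
def Logic.NonDegenerate (L : Logic.{u}) : Prop :=
  ∃ (τ : Signature) (ψ : ℕ), ψ ∈ L.Sentence τ ∧ L.models τ ψ = ∅

/-! ### Decidable problems -/

/-- A decision problem has inputs `i : ι` and yes-instances given by `Yes`; `Codes w i` says that
the finite datum `w : α` is a code of the input `i`. The problem is decidable if some algorithm
halts with the right answer on every code of every input. (On data that are not codes of inputs the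
algorithm may behave arbitrarily.) -/
def IsDecidableProblem {α : Type} [Primcodable α] {ι : Type*} (Codes : α → ι → Prop)
    (Yes : ι → Prop) : Prop :=
  ∃ f : α →. Bool, Partrec f ∧
    ∀ w i, Codes w i → (Yes i → true ∈ f w) ∧ (¬ Yes i → false ∈ f w)

/-- Codes of signatures: a list of the constants and a list of the predicates. -/
abbrev SigCode : Type := List ℕ × List (ℕ × ℕ)

def CodesSig (w : SigCode) (τ : Signature) : Prop :=
  (∀ c, c ∈ w.1 ↔ c ∈ τ.consts) ∧ (∀ p, p ∈ w.2 ↔ p ∈ τ.preds)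

/-- Codes of finite structures: the signature, the size `n` of the domain (which is then identified
with `{0, …, n - 1}`), a list of the values of the constants, and a list of the tuples in the
relations. -/
abbrev StrCode : Type := SigCode × ℕ × List (ℕ × ℕ) × List (ℕ × List ℕ)

def CodesStr (w : StrCode) {τ : Signature} (A : Str.{u} τ) : Prop :=
  CodesSig w.1 τ ∧ ∃ e : A ≃ Fin w.2.1,
    (∀ c m : ℕ, (c, m) ∈ w.2.2.1 ↔ ∃ hc : c ∈ τ.consts, m = e (A.const c hc)) ∧
    (∀ (P : ℕ) (l : List ℕ), (P, l) ∈ w.2.2.2 ↔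
      ∃ (k : ℕ) (hP : (P, k) ∈ τ.preds) (a : Fin k → A),
        A.pred P k hP a ∧ l = List.ofFn fun i => (e (a i) : ℕ))

/-- Gödel numbers of terms. -/
def termCode {τ : Signature} {n : ℕ} : τ.lang.Term (Empty ⊕ Fin n) → ℕ
  | .var (.inr i) => 2 * i
  | .func (.const c _) _ => 2 * c + 1

/-- Gödel numbers of first-order formulas. -/
def formulaCode {τ : Signature} : {n : ℕ} → τ.lang.BoundedFormula Empty n → ℕ
  | _, .falsum => Nat.pair 0 0
  | _, .equal t s => Nat.pair 1 (Nat.pair (termCode t) (termCode s))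
  | _, .rel R ts =>
      Nat.pair 2 (Nat.pair R.1 (Encodable.encode (List.ofFn fun i => termCode (ts i))))
  | _, .imp φ ψ => Nat.pair 3 (Nat.pair (formulaCode φ) (formulaCode ψ))
  | _, .all φ => Nat.pair 4 (formulaCode φ)

/-- Inputs: a signature `τ` and a first-order `τ`-sentence (with equality). -/
abbrev FOInput : Type := Σ τ : Signature, τ.lang.Sentence

def CodesFOInput (w : SigCode × ℕ) (i : FOInput) : Prop :=
  CodesSig w.1 i.1 ∧ w.2 = formulaCode i.2

/-- Inputs of the model checking problem of `L`: a signature `τ`, a `τ`-sentence of `L`, and a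
finite `τ`-structure. -/
structure MCInput (L : Logic.{u}) where
  sig : Signature
  sentence : ℕ
  sentence_mem : sentence ∈ L.Sentence sig
  str : Str.{u} sig
  finite_str : Finite str

/-- The model checking problem of `L` is decidable. -/
def Logic.DecidableModelChecking (L : Logic.{u}) : Prop :=
  IsDecidableProblem
    (fun (w : ℕ × StrCode) (i : MCInput L) => w.1 = i.sentence ∧ CodesStr w.2 i.str)
    (fun i => L.Sat i.str i.sentence)

/-! ### Characterizability of homomorphism closures -/

/-- The homomorphism closure of the class of models of `Φ` is characterized by an `L`-sentence. -/
def ExCharHomCl (L : Logic.{u}) (i : FOInput) : Prop :=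
  ∃ ψ ∈ L.Sentence i.1, L.models i.1 ψ = homCl (foModels i.2)

/-- The finite homomorphism closure of the class of finite models of `Φ` is finitely
characterized by an `L`-sentence. -/
def ExCharHomClFin (L : Logic.{u}) (i : FOInput) : Prop :=
  ∃ ψ ∈ L.Sentence i.1, finPart (L.models i.1 ψ) = homClFin (finPart (foModels i.2))

end HomClosure

namespace HomClosure

/-! ### Production systems on binary trees -/

/-- Finite binary trees. -/
inductive Tr : Type
  | leaf : Tr
  | node : Tr → Tr → Tr

namespace Tr

/-- The numeral of `n`: a right comb with `n` inner nodes. -/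
def num : ℕ → Tr
  | 0 => leaf
  | n + 1 => node leaf (num n)

theorem num_injective : Function.Injective num := by
  intro a
  induction a with
  | zero => intro b h; cases b with
    | zero => rfl
    | succ b => cases h
  | succ a ih => intro b h; cases b with
    | zero => cases h
    | succ b => rw [ih (Tr.node.inj h).2]

/-- The number of leaves. -/
def size : Tr → ℕ
  | leaf => 1
  | node a b => size a + size b

theorem one_le_size : ∀ t : Tr, 1 ≤ t.size
  | leaf => le_rfl
  | node a _ => (one_le_size a).trans (Nat.le_add_right _ _)

theorem size_left_lt (a b : Tr) : a.size < (node a b).size := by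
  have := one_le_size b
  simp only [size]; omega

theorem size_right_lt (a b : Tr) : b.size < (node a b).size := by
  have := one_le_size a
  simp only [size]; omega

theorem size_num (n : ℕ) : (num n).size = n + 1 := by
  induction n with
  | zero => rfl
  | succ n ih => simp only [num, size, ih]; omega

theorem finite_size_le (N : ℕ) : {t : Tr | t.size ≤ N}.Finite := by
  induction N with
  | zero =>
    refine Set.Finite.subset Set.finite_empty fun t ht => ?_
    have := one_le_size t
    simp only [Set.mem_ofPred_eq] at ht
    omega
  | succ N ih =>
    refine Set.Finite.subset ((Set.finite_singleton leaf).union (ih.image2 node ih)) ?_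
    intro t ht
    cases t with
    | leaf => exact Or.inl rfl
    | node a b =>
      have h1 := size_left_lt a b
      have h2 := size_right_lt a b
      simp only [Set.mem_ofPred_eq] at ht
      exact Or.inr ⟨a, Nat.lt_succ_iff.1 (h1.trans_le ht), b, Nat.lt_succ_iff.1 (h2.trans_le ht), rfl⟩

end Tr

/-- Tree patterns with variables `0, …, k - 1`. -/
inductive Pat (k : ℕ) : Type
  | var : Fin k → Pat k
  | leaf : Pat k
  | node : Pat k → Pat k → Pat k

/-- Substitution of trees for the variables of a pattern. -/
def Pat.sub {k : ℕ} (s : Fin k → Tr) : Pat k → Tr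
  | .var i => s i
  | .leaf => .leaf
  | .node P Q => .node (P.sub s) (Q.sub s)

/-- A production rule: a conclusion and two premises. -/
abbrev Rule : Type := Pat 6 × Pat 6 × Pat 6

/-- The trees produced by a list of rules from the tree `leaf`. -/
inductive Ev (rs : List Rule) : Tr → Prop
  | base : Ev rs .leaf
  | step (r : Rule) (hr : r ∈ rs) (s : Fin 6 → Tr) :
      Ev rs (r.2.1.sub s) → Ev rs (r.2.2.sub s) → Ev rs (r.1.sub s)

/-! ### A production system with an undecidable set of numerals -/

namespace Interp

open Turing ToPartrec

/-- The tree of a list of numbers. -/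
def encList : List ℕ → Tr
  | [] => .leaf
  | n :: l => .node (.num n) (encList l)

/-- The tree of a program. -/
def encCode : Code → Tr
  | .zero' => .node (.num 0) .leaf
  | .succ => .node (.num 1) .leaf
  | .tail => .node (.num 2) .leaf
  | .cons f g => .node (.num 3) (.node (encCode f) (encCode g))
  | .comp f g => .node (.num 4) (.node (encCode f) (encCode g))
  | .case f g => .node (.num 5) (.node (encCode f) (encCode g))
  | .fix f => .node (.num 6) (encCode f)

/-- A tree as a pattern without variables. -/
def quote {k : ℕ} : Tr → Pat k
  | .leaf => .leaf
  | .node a b => .node (quote a) (quote b)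

theorem sub_quote {k : ℕ} (s : Fin k → Tr) (t : Tr) : (quote t).sub s = t := by
  induction t with
  | leaf => rfl
  | node a b iha ihb => simp only [quote, Pat.sub, iha, ihb]

/-- The judgement that the program `c` maps `v` to `w`. -/
def trip (c v w : Pat 6) : Pat 6 := .node c (.node v w)

/-- The same judgement on trees. -/
def ttrip (c v w : Tr) : Tr := .node c (.node v w)

/-- The pattern of a program with head symbol number `i`. -/
def tag (i : ℕ) (P : Pat 6) : Pat 6 := .node (quote (.num i)) P

local notation "x₀" => (Pat.var 0 : Pat 6)
local notation "x₁" => (Pat.var 1 : Pat 6)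
local notation "x₂" => (Pat.var 2 : Pat 6)
local notation "x₃" => (Pat.var 3 : Pat 6)
local notation "x₄" => (Pat.var 4 : Pat 6)
local notation "x₅" => (Pat.var 5 : Pat 6)

/-- The rules of an interpreter for programs, and a rule that tests if `u` halts on a number. -/
def rules (u : Code) : List Rule :=
  [(trip (tag 0 .leaf) x₀ (.node .leaf x₀), .leaf, .leaf),
   (trip (tag 1 .leaf) .leaf (.node (.node .leaf .leaf) .leaf), .leaf, .leaf),
   (trip (tag 1 .leaf) (.node x₀ x₁) (.node (.node .leaf x₀) .leaf), .leaf, .leaf),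
   (trip (tag 2 .leaf) .leaf .leaf, .leaf, .leaf),
   (trip (tag 2 .leaf) (.node x₀ x₁) x₁, .leaf, .leaf),
   (trip (tag 3 (.node x₀ x₁)) x₂ (.node x₃ x₄), trip x₀ x₂ (.node x₃ x₅), trip x₁ x₂ x₄),
   (trip (tag 3 (.node x₀ x₁)) x₂ (.node .leaf x₄), trip x₀ x₂ .leaf, trip x₁ x₂ x₄),
   (trip (tag 4 (.node x₀ x₁)) x₂ x₃, trip x₁ x₂ x₄, trip x₀ x₄ x₃),
   (trip (tag 5 (.node x₀ x₁)) .leaf x₃, trip x₀ .leaf x₃, .leaf),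
   (trip (tag 5 (.node x₀ x₁)) (.node .leaf x₂) x₃, trip x₀ x₂ x₃, .leaf),
   (trip (tag 5 (.node x₀ x₁)) (.node (.node .leaf x₄) x₂) x₃, trip x₁ (.node x₄ x₂) x₃, .leaf),
   (trip (tag 6 x₀) x₁ x₂, trip x₀ x₁ (.node .leaf x₂), .leaf),
   (trip (tag 6 x₀) x₁ .leaf, trip x₀ x₁ .leaf, .leaf),
   (trip (tag 6 x₀) x₁ x₂, trip x₀ x₁ (.node (.node .leaf x₃) x₄), trip (tag 6 x₀) x₄ x₂),
   (.node .leaf x₀, trip (quote (encCode u)) (.node x₀ .leaf) x₁, .leaf)]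

theorem encCode_ne_leaf (c : Code) : encCode c ≠ .leaf := by
  cases c <;> simp [encCode]

theorem encList_eq_leaf {v : List ℕ} (h : encList v = .leaf) : v = [] := by
  cases v
  · rfl
  · cases h

theorem encList_eq_node {v : List ℕ} {a b : Tr} (h : encList v = .node a b) :
    ∃ n l, v = n :: l ∧ a = .num n ∧ b = encList l := by
  cases v with
  | nil => cases h
  | cons n l => cases h; exact ⟨n, l, rfl, rfl, rfl⟩

theorem num_eq_leaf {n : ℕ} (h : Tr.num n = .leaf) : n = 0 := by
  cases n
  · rfl
  · cases h

theorem num_eq_node {n : ℕ} {a b : Tr} (h : Tr.num n = .node a b) :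
    ∃ k, n = k + 1 ∧ a = .leaf ∧ b = .num k := by
  cases n with
  | zero => cases h
  | succ n => cases h; exact ⟨n, rfl, rfl, rfl⟩

theorem mem_fix_iff {f : Code} {v w : List ℕ} : w ∈ (Code.fix f).eval v ↔
    ∃ y ∈ f.eval v, (y.headI = 0 ∧ w = y.tail) ∨ (y.headI ≠ 0 ∧ w ∈ (Code.fix f).eval y.tail) := by
  have e : (Code.fix f).eval = PFun.fix fun v => (f.eval v).map fun v =>
      if v.headI = 0 then Sum.inl v.tail else Sum.inr v.tail := Code.fix_eval f
  rw [e]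
  refine PFun.mem_fix_iff.trans ?_
  constructor
  · rintro (h | ⟨y, h, h'⟩)
    · obtain ⟨y, hy, e⟩ := (Part.mem_map_iff _).1 h
      by_cases h0 : y.headI = 0
      · rw [if_pos h0] at e; exact ⟨y, hy, .inl ⟨h0, (Sum.inl.inj e).symm⟩⟩
      · rw [if_neg h0] at e; cases e
    · obtain ⟨x, hx, e⟩ := (Part.mem_map_iff _).1 h
      by_cases h0 : x.headI = 0
      · rw [if_pos h0] at e; cases e
      · rw [if_neg h0] at e; obtain rfl := Sum.inr.inj e; exact ⟨x, hx, .inr ⟨h0, h'⟩⟩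
  · rintro ⟨y, hy, ⟨h0, rfl⟩ | ⟨h0, h⟩⟩
    · exact .inl ((Part.mem_map_iff _).2 ⟨y, hy, by rw [if_pos h0]⟩)
    · exact .inr ⟨_, (Part.mem_map_iff _).2 ⟨y, hy, by rw [if_neg h0]⟩, h⟩

theorem mem_cons_iff {f g : Code} {v w : List ℕ} : w ∈ (Code.cons f g).eval v ↔
    ∃ a ∈ f.eval v, ∃ b ∈ g.eval v, w = a.headI :: b := by
  simp [Part.bind_eq_bind, Part.pure_eq_some]

theorem mem_comp_iff {f g : Code} {v w : List ℕ} : w ∈ (Code.comp f g).eval v ↔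
    ∃ a ∈ g.eval v, w ∈ f.eval a := by
  rw [Code.comp_eval]
  exact Part.mem_bind_iff

/-- The meaning of the judgements of the interpreter. -/
def Sound (u : Code) (t : Tr) : Prop :=
  (∀ c v w, t = ttrip (encCode c) (encList v) w → ∃ y ∈ c.eval v, w = encList y) ∧
  (∀ n, t = .node .leaf (.num n) → (u.eval [n]).Dom)

theorem sub_trip (s : Fin 6 → Tr) (c v w : Pat 6) :
    (trip c v w).sub s = ttrip (c.sub s) (v.sub s) (w.sub s) := rfl

theorem sub_tag (s : Fin 6 → Tr) (i : ℕ) (P : Pat 6) :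
    (tag i P).sub s = .node (.num i) (P.sub s) := by
  simp only [tag, Pat.sub, sub_quote]

theorem sound_ttrip {u : Code} {c₀ v₀ w₀ : Tr} (hc : c₀ ≠ .leaf)
    (h : ∀ c v, c₀ = encCode c → v₀ = encList v → ∃ y ∈ c.eval v, w₀ = encList y) :
    Sound u (ttrip c₀ v₀ w₀) := by
  refine ⟨fun c v w e => ?_, fun n e => ?_⟩
  · obtain ⟨h1, h2⟩ := Tr.node.inj e
    obtain ⟨h3, rfl⟩ := Tr.node.inj h2
    exact h c v h1 h3
  · exact absurd (Tr.node.inj e).1 hc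

theorem sound_of_ev {u : Code} {t : Tr} (ht : Ev (rules u) t) : Sound u t := by
  induction ht with
  | base => exact ⟨fun _ _ _ h => by (cases h), fun _ h => by (cases h)⟩
  | step r hr s h1 h2 ih1 ih2 =>
    clear h1 h2
    simp only [rules, List.mem_cons, List.not_mem_nil, or_false] at hr
    rcases hr with rfl | rfl | rfl | rfl | rfl | rfl | rfl | rfl | rfl | rfl | rfl | rfl | rfl |
      rfl | rfl
    case inr.inr.inr.inr.inr.inr.inr.inr.inr.inr.inr.inr.inr.inr =>
      refine ⟨fun c v w h => absurd (Tr.node.inj h).1.symm (encCode_ne_leaf c), fun n h => ?_⟩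
      have e : s 0 = .num n := (Tr.node.inj h).2
      obtain ⟨y, hy, -⟩ := ih1.1 u [n] (s 1) (by
        simp only [sub_trip, sub_quote, Pat.sub, encList, e])
      exact Part.dom_iff_mem.2 ⟨y, hy⟩
    all_goals
      simp only [sub_trip, sub_tag, Pat.sub] at ih1 ih2 ⊢
      refine sound_ttrip (by simp) fun c v hc hv => ?_
      replace ih1 := ih1.1
      replace ih2 := ih2.1
      cases c <;> simp [encCode, Tr.num] at hc
    · exact ⟨0 :: v, by simp, by simp [encList, Tr.num, hv]⟩
    · obtain rfl := encList_eq_leaf hv.symm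
      exact ⟨[1], by simp, rfl⟩
    · obtain ⟨n, l, rfl, h0, h1⟩ := encList_eq_node hv.symm
      exact ⟨[n + 1], by simp, by simp [encList, Tr.num, h0]⟩
    · obtain rfl := encList_eq_leaf hv.symm
      exact ⟨[], by simp, rfl⟩
    · obtain ⟨n, l, rfl, h0, h1⟩ := encList_eq_node hv.symm
      exact ⟨l, by simp, h1⟩
    · obtain ⟨y, hy, ey⟩ := ih1 _ v _ (by rw [hc.1, hv])
      obtain ⟨z, hz, ez⟩ := ih2 _ v _ (by rw [hc.2, hv])
      obtain ⟨n, l, rfl, h0, h1⟩ := encList_eq_node ey.symm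
      exact ⟨n :: z, mem_cons_iff.2 ⟨_, hy, _, hz, rfl⟩, by simp [encList, h0, ez]⟩
    · obtain ⟨y, hy, ey⟩ := ih1 _ v _ (by rw [hc.1, hv])
      obtain ⟨z, hz, ez⟩ := ih2 _ v _ (by rw [hc.2, hv])
      obtain rfl := encList_eq_leaf ey.symm
      exact ⟨0 :: z, mem_cons_iff.2 ⟨_, hy, _, hz, rfl⟩, by simp [encList, Tr.num, ez]⟩
    · obtain ⟨y, hy, ey⟩ := ih1 _ v _ (by rw [hc.2, hv])
      obtain ⟨z, hz, ez⟩ := ih2 _ y _ (by rw [hc.1, ey])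
      exact ⟨z, mem_comp_iff.2 ⟨_, hy, hz⟩, ez⟩
    · obtain rfl := encList_eq_leaf hv.symm
      obtain ⟨y, hy, ey⟩ := ih1 _ [] _ (by rw [hc.1]; rfl)
      exact ⟨y, by simpa using hy, ey⟩
    · obtain ⟨n, l, rfl, h0, h1⟩ := encList_eq_node hv.symm
      obtain rfl := num_eq_leaf h0.symm
      obtain ⟨y, hy, ey⟩ := ih1 _ l _ (by rw [hc.1, h1])
      exact ⟨y, by simpa using hy, ey⟩
    · obtain ⟨n, l, rfl, h0, h1⟩ := encList_eq_node hv.symm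
      obtain ⟨k, rfl, -, h2⟩ := num_eq_node h0.symm
      obtain ⟨y, hy, ey⟩ := ih1 _ (k :: l) _ (by rw [hc.2, h1, h2]; rfl)
      exact ⟨y, by simpa using hy, ey⟩
    · obtain ⟨y, hy, ey⟩ := ih1 _ v _ (by rw [hc, hv])
      obtain ⟨n, l, rfl, h0, h1⟩ := encList_eq_node ey.symm
      obtain rfl := num_eq_leaf h0.symm
      exact ⟨l, mem_fix_iff.2 ⟨_, hy, .inl ⟨rfl, rfl⟩⟩, h1⟩
    · obtain ⟨y, hy, ey⟩ := ih1 _ v _ (by rw [hc, hv])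
      obtain rfl := encList_eq_leaf ey.symm
      exact ⟨[], mem_fix_iff.2 ⟨_, hy, .inl ⟨rfl, rfl⟩⟩, rfl⟩
    · obtain ⟨y, hy, ey⟩ := ih1 _ v _ (by rw [hc, hv])
      obtain ⟨n, l, rfl, h0, h1⟩ := encList_eq_node ey.symm
      obtain ⟨k, rfl, -, h2⟩ := num_eq_node h0.symm
      rename_i f
      obtain ⟨z, hz, ez⟩ := ih2 (.fix f) l (s 2) (by rw [hc, h1]; rfl)
      exact ⟨z, mem_fix_iff.2 ⟨_, hy, .inr ⟨by simp, hz⟩⟩, ez⟩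

/-- Application of the rule number `i` of the interpreter. -/
theorem ev_rule {u : Code} (s : Fin 6 → Tr) (i : Fin 15) {t : Tr}
    (h1 : Ev (rules u) (((rules u).get i).2.1.sub s))
    (h2 : Ev (rules u) (((rules u).get i).2.2.sub s))
    (h : ((rules u).get i).1.sub s = t) : Ev (rules u) t :=
  h ▸ Ev.step _ (List.get_mem _ _) s h1 h2

theorem ev_of_mem (u c : Code) : ∀ v, ∀ w ∈ c.eval v,
    Ev (rules u) (ttrip (encCode c) (encList v) (encList w)) := by
  induction c with
  | zero' =>
    intro v w hw
    simp at hw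
    subst hw
    exact ev_rule ![encList v, .leaf, .leaf, .leaf, .leaf, .leaf] 0 .base .base rfl
  | succ =>
    intro v w hw
    simp at hw
    subst hw
    cases v with
    | nil => exact ev_rule ![.leaf, .leaf, .leaf, .leaf, .leaf, .leaf] 1 .base .base rfl
    | cons n l =>
      exact ev_rule ![.num n, encList l, .leaf, .leaf, .leaf, .leaf] 2 .base .base rfl
  | tail =>
    intro v w hw
    simp at hw
    subst hw
    cases v with
    | nil => exact ev_rule ![.leaf, .leaf, .leaf, .leaf, .leaf, .leaf] 3 .base .base rfl
    | cons n l =>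
      exact ev_rule ![.num n, encList l, .leaf, .leaf, .leaf, .leaf] 4 .base .base rfl
  | cons f g hf hg =>
    intro v w hw
    obtain ⟨a, ha, b, hb, rfl⟩ := mem_cons_iff.1 hw
    cases a with
    | nil =>
      exact ev_rule ![encCode f, encCode g, encList v, .leaf, encList b, .leaf] 6
        (hf v _ ha) (hg v _ hb) rfl
    | cons n l =>
      exact ev_rule ![encCode f, encCode g, encList v, .num n, encList b, encList l] 5
        (hf v _ ha) (hg v _ hb) rfl
  | comp f g hf hg =>
    intro v w hw
    obtain ⟨a, ha, hb⟩ := mem_comp_iff.1 hw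
    exact ev_rule ![encCode f, encCode g, encList v, encList w, encList a, .leaf] 7
      (hg v _ ha) (hf a _ hb) rfl
  | case f g hf hg =>
    intro v w hw
    rcases v with _ | ⟨_ | n, l⟩
    · exact ev_rule ![encCode f, encCode g, .leaf, encList w, .leaf, .leaf] 8
        (hf [] w (by simpa using hw)) .base rfl
    · exact ev_rule ![encCode f, encCode g, encList l, encList w, .leaf, .leaf] 9
        (hf l w (by simpa using hw)) .base rfl
    · exact ev_rule ![encCode f, encCode g, encList l, encList w, .num n, .leaf] 10
        (hg (n :: l) w (by simpa using hw)) .base rfl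
  | fix f hf =>
    intro v w hw
    have e : (Code.fix f).eval = PFun.fix fun v => (f.eval v).map fun v =>
      if v.headI = 0 then Sum.inl v.tail else Sum.inr v.tail := Code.fix_eval f
    rw [e] at hw
    refine PFun.fixInduction' (C := fun v => Ev (rules u)
      (ttrip (encCode (.fix f)) (encList v) (encList w))) hw ?_ ?_
    · intro v h
      obtain ⟨y, hy, h⟩ := (Part.mem_map_iff _).1 h
      split_ifs at h with h0
      obtain rfl := Sum.inl.inj h
      rcases y with _ | ⟨n, l⟩
      · exact ev_rule ![encCode f, encList v, .leaf, .leaf, .leaf, .leaf] 12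
          (hf v _ hy) .base rfl
      · obtain rfl : n = 0 := h0
        exact ev_rule ![encCode f, encList v, encList l, .leaf, .leaf, .leaf] 11
          (hf v _ hy) .base rfl
    · intro v v' _ h ih
      obtain ⟨y, hy, h⟩ := (Part.mem_map_iff _).1 h
      split_ifs at h with h0
      obtain rfl := Sum.inr.inj h
      rcases y with _ | ⟨_ | n, l⟩
      · exact absurd rfl h0
      · exact absurd rfl h0
      · exact ev_rule ![encCode f, encList v, encList w, .num n, encList l, .leaf] 13
          (hf v _ hy) ih rfl

theorem ev_num_succ_iff (u : Code) (n : ℕ) :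
    Ev (rules u) (.num (n + 1)) ↔ (u.eval [n]).Dom := by
  refine ⟨fun h => (sound_of_ev h).2 n rfl, fun h => ?_⟩
  obtain ⟨w, hw⟩ := Part.dom_iff_mem.1 h
  exact ev_rule ![.num n, encList w, .leaf, .leaf, .leaf, .leaf] 14
    (by
      change Ev (rules u) (ttrip ((quote (encCode u)).sub _) _ _)
      rw [sub_quote]
      exact ev_of_mem u u _ _ hw) .base rfl

end Interp

/-- Some production system produces an undecidable set of numerals. -/
theorem exists_rules_undecidable :
    ∃ rs : List Rule, ¬ ComputablePred fun n => Ev rs (.num (n + 1)) := by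
  have hf : Partrec fun n : ℕ => Nat.Partrec.Code.eval (Denumerable.ofNat Nat.Partrec.Code n) 0 :=
    Nat.Partrec.Code.eval_part.comp (Computable.ofNat _) (Computable.const 0)
  obtain ⟨u, hu⟩ := Turing.ToPartrec.Code.exists_code (Nat.Partrec'.part_iff₁.2 hf)
  refine ⟨Interp.rules u, fun h => ComputablePred.halting_problem 0 ?_⟩
  refine (ComputablePred.computable_of_manyOneReducible
    (q := fun n => Ev (Interp.rules u) (.num (n + 1))) ⟨Encodable.encode, Computable.encode, ?_⟩ h)
  intro c
  have := hu (Encodable.encode c ::ᵥ List.Vector.nil)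
  refine Iff.trans ?_ (Interp.ev_num_succ_iff u (Encodable.encode c)).symm
  have e : u.eval [Encodable.encode c] = _ := this
  rw [e]
  simp

/-! ### Axioms for infinite and for finite models of a production system -/

/-- The data used by the axioms below: the least tree `l`, the ends `z` and `d` of a path, a
distinguished tree `g`, the graph `node` of the pairing of trees, the set `G` of produced trees, the
edges `R` of the path, the values `V` of the path's elements, and two strict orders. -/
structure Data (A : Type u) where
  l : A
  z : A
  d : A
  g : A
  node : A → A → A → Prop
  G : A → Prop
  R : A → A → Prop
  V : A → A → Prop
  lt₁ : A → A → Prop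
  lt₂ : A → A → Prop

/-- An element matches a pattern under an assignment of elements to the variables. -/
def Pat.Mat {A : Type u} (D : Data A) {k : ℕ} (s : Fin k → A) : Pat k → A → Prop
  | .var i, a => a = s i
  | .leaf, a => a = D.l
  | .node P Q, a => ∃ b c, P.Mat D s b ∧ Q.Mat D s c ∧ D.node b c a

/-- Axioms saying that `G` contains all produced trees, but not `g` nor the successor of the length
of the path. -/
structure InfAx (rs : List Rule) {A : Type u} (D : Data A) : Prop where
  node_ex : ∀ x y, ∃ w, D.node x y w
  node_fun : ∀ x y w w', D.node x y w → D.node x y w' → w = w'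
  base : D.G D.l
  rule : ∀ r ∈ rs, ∀ s : Fin 6 → A, ∀ p q q', r.1.Mat D s p → r.2.1.Mat D s q → r.2.2.Mat D s q' →
    D.G q → D.G q' → D.G p
  start : D.V D.z D.l
  path : ∀ x v, D.V x v → x = D.d ∨ ∃ y w, D.R x y ∧ D.V y w ∧ D.node D.l v w
  finish_not : ∀ v p, D.V D.d v → D.node D.l v p → ¬ D.G p
  goal_not : ¬ D.G D.g

/-- Axioms saying, in a finite structure, that `G` contains only produced trees, and contains `g`
and the successor of the length of the path. -/
structure FinAx (rs : List Rule) {A : Type u} (D : Data A) : Prop where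
  irrefl₁ : ∀ x, ¬ D.lt₁ x x
  irrefl₂ : ∀ x, ¬ D.lt₂ x x
  trans₁ : ∀ x y w, D.lt₁ x y → D.lt₁ y w → D.lt₁ x w
  trans₂ : ∀ x y w, D.lt₂ x y → D.lt₂ y w → D.lt₂ x w
  node_lt : ∀ x y w, D.node x y w → D.lt₁ x w ∧ D.lt₁ y w
  node_inj : ∀ x y x' y' w, D.node x y w → D.node x' y' w → x = x' ∧ y = y'
  node_ne : ∀ x y, ¬ D.node x y D.l
  rule : ∀ p, D.G p → p = D.l ∨ ∃ r ∈ rs, ∃ s : Fin 6 → A, ∃ q q', r.1.Mat D s p ∧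
    r.2.1.Mat D s q ∧ r.2.2.Mat D s q' ∧ D.G q ∧ D.G q' ∧ D.lt₂ q p ∧ D.lt₂ q' p
  path : ∀ x v, D.V x v → (x = D.z ∧ v = D.l) ∨ ∃ y w, D.R y x ∧ D.V y w ∧ D.node D.l w v
  finish : ∃ v p, D.V D.d v ∧ D.node D.l v p ∧ D.G p
  goal : D.G D.g

/-- The interpretation of trees in a model of the axioms. -/
noncomputable def InfAx.val {rs : List Rule} {A : Type u} {D : Data A} (h : InfAx rs D) : Tr → A
  | .leaf => D.l
  | .node a b => (h.node_ex (h.val a) (h.val b)).choose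

namespace InfAx

variable {rs : List Rule} {A : Type u} {D : Data A}

theorem node_val (h : InfAx rs D) (a b : Tr) : D.node (h.val a) (h.val b) (h.val (.node a b)) :=
  (h.node_ex (h.val a) (h.val b)).choose_spec

theorem mat_val (h : InfAx rs D) {k : ℕ} (s : Fin k → Tr) (P : Pat k) :
    P.Mat D (fun i => h.val (s i)) (h.val (P.sub s)) := by
  induction P with
  | var i => rfl
  | leaf => rfl
  | node P Q ihP ihQ => exact ⟨_, _, ihP, ihQ, h.node_val _ _⟩

theorem val_of_ev (h : InfAx rs D) {t : Tr} (ht : Ev rs t) : D.G (h.val t) := by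
  induction ht with
  | base => exact h.base
  | step r hr s _ _ ih1 ih2 =>
    exact h.rule r hr _ _ _ _ (h.mat_val s _) (h.mat_val s _) (h.mat_val s _) ih1 ih2

theorem eq_val_num (h : InfAx rs D) {v w : A} {n : ℕ} (hv : v = h.val (.num n)) (hw : D.node D.l v w) :
    w = h.val (.num (n + 1)) :=
  h.node_fun _ _ _ _ hw (hv ▸ h.node_val .leaf (.num n))

/-- If the path maps to a path of length `n`, then `n + 1` is not produced. -/
theorem not_ev_of_path (h : InfAx rs D) {n : ℕ} (f : A → ℕ) (hz : f D.z = 0) (hd : f D.d = n)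
    (hR : ∀ x y, D.R x y → f y = f x + 1 ∧ f x < n) : ¬ Ev rs (.num (n + 1)) := by
  have key : ∀ i, (∃ j, j < i ∧ j = n ∧ D.V D.d (h.val (.num j))) ∨
      ∃ x, f x = i ∧ D.V x (h.val (.num i)) := by
    intro i
    induction i with
    | zero => exact .inr ⟨_, hz, h.start⟩
    | succ i ih =>
      rcases ih with ⟨j, hj, hn, hv⟩ | ⟨x, hx, hv⟩
      · exact .inl ⟨j, by omega, hn, hv⟩
      · rcases h.path _ _ hv with rfl | ⟨y, w, hR', hy, hw⟩
        · exact .inl ⟨i, by omega, by omega, hv⟩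
        · rw [h.eq_val_num rfl hw] at hy
          exact .inr ⟨y, by rw [(hR _ _ hR').1, hx], hy⟩
  have hV : D.V D.d (h.val (.num n)) := by
    rcases key n with ⟨j, hj, rfl, -⟩ | ⟨x, hx, hv⟩
    · exact absurd hj (lt_irrefl _)
    · rcases h.path _ _ hv with rfl | ⟨y, w, hR', -⟩
      · exact hv
      · exact absurd (hR _ _ hR').2 (by omega)
  exact fun he => h.finish_not _ _ hV (h.node_val .leaf (.num n)) (h.val_of_ev he)

theorem not_ev_of_chain (h : InfAx rs D) {m : ℕ} (k : ℕ → A) (h0 : k 0 = D.g) (hm : k m = D.l)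
    (hk : ∀ i < m, D.node D.l (k (i + 1)) (k i)) : ¬ Ev rs (.num m) := by
  have key : ∀ i ≤ m, k (m - i) = h.val (.num i) := by
    intro i
    induction i with
    | zero => intro _; exact hm
    | succ i ih =>
      intro hi
      have := hk (m - (i + 1)) (by omega)
      rw [show m - (i + 1) + 1 = m - i by omega] at this
      exact h.eq_val_num (ih (by omega)) this
  intro he
  have := h.val_of_ev he
  rw [← key m le_rfl, Nat.sub_self, h0] at this
  exact h.goal_not this

end InfAx

namespace FinAx

variable {rs : List Rule} {A : Type u} {D : Data A}

theorem wf₁ (h : FinAx rs D) [Finite A] : WellFounded D.lt₁ :=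
  haveI : Std.Irrefl D.lt₁ := ⟨h.irrefl₁⟩
  haveI : IsTrans A D.lt₁ := ⟨h.trans₁⟩
  Finite.wellFounded_of_trans_of_irrefl _

theorem wf₂ (h : FinAx rs D) [Finite A] : WellFounded D.lt₂ :=
  haveI : Std.Irrefl D.lt₂ := ⟨h.irrefl₂⟩
  haveI : IsTrans A D.lt₂ := ⟨h.trans₂⟩
  Finite.wellFounded_of_trans_of_irrefl _

/-- The elements of a finite model of the axioms are trees. -/
theorem exists_val (h : FinAx rs D) [Finite A] : ∃ f : A → Tr, f D.l = .leaf ∧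
    ∀ x y w, D.node x y w → f w = .node (f x) (f y) := by
  classical
  let F : ∀ w, (∀ x, D.lt₁ x w → Tr) → Tr := fun w f =>
    if e : ∃ x y, D.node x y w then
      .node (f e.choose (h.node_lt _ _ _ e.choose_spec.choose_spec).1)
        (f e.choose_spec.choose (h.node_lt _ _ _ e.choose_spec.choose_spec).2)
    else .leaf
  refine ⟨h.wf₁.fix F, ?_, fun x y w hw => ?_⟩
  · rw [h.wf₁.fix_eq]
    exact dif_neg fun ⟨x, y, e⟩ => h.node_ne x y e
  · rw [h.wf₁.fix_eq]
    have e : ∃ x y, D.node x y w := ⟨x, y, hw⟩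
    obtain ⟨h1, h2⟩ := h.node_inj _ _ _ _ _ e.choose_spec.choose_spec hw
    exact (dif_pos e).trans
      (congrArg₂ (fun a b => Tr.node (h.wf₁.fix F a) (h.wf₁.fix F b)) h1 h2)

theorem eq_sub_of_mat {f : A → Tr} (h0 : f D.l = .leaf)
    (hf : ∀ x y w, D.node x y w → f w = .node (f x) (f y)) {k : ℕ} (s : Fin k → A) (P : Pat k) :
    ∀ a, P.Mat D s a → f a = P.sub (fun i => f (s i)) := by
  induction P with
  | var i => rintro a rfl; rfl
  | leaf => rintro a rfl; exact h0
  | node P Q ihP ihQ =>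
    rintro a ⟨b, c, hb, hc, hn⟩
    rw [hf _ _ _ hn, ihP _ hb, ihQ _ hc]; rfl

theorem ev_of_val (h : FinAx rs D) [Finite A] {f : A → Tr} (h0 : f D.l = .leaf)
    (hf : ∀ x y w, D.node x y w → f w = .node (f x) (f y)) (p : A) : D.G p → Ev rs (f p) := by
  induction p using h.wf₂.induction with
  | _ p ih =>
    intro hp
    rcases h.rule p hp with rfl | ⟨r, hr, s, q, q', mp, mq, mq', hq, hq', lq, lq'⟩
    · rw [h0]; exact .base
    · have h1 := ih q lq hq
      have h2 := ih q' lq' hq'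
      rw [eq_sub_of_mat h0 hf s _ _ mq] at h1
      rw [eq_sub_of_mat h0 hf s _ _ mq'] at h2
      rw [eq_sub_of_mat h0 hf s _ _ mp]
      exact .step r hr _ h1 h2

theorem ev_of_path (h : FinAx rs D) [Finite A] {n : ℕ} (f : A → ℕ) (hz : f D.z = 0) (hd : f D.d = n)
    (hR : ∀ x y, D.R x y → f y = f x + 1) : Ev rs (.num (n + 1)) := by
  obtain ⟨φ, h0, hφ⟩ := h.exists_val
  obtain ⟨v, p, hv, hp, hG⟩ := h.finish
  have key : ∀ v x, D.V x v → φ v = .num (f x) := by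
    intro v
    induction v using h.wf₁.induction with
    | _ v ih =>
      intro x hx
      rcases h.path x v hx with ⟨rfl, rfl⟩ | ⟨y, w, hR', hy, hw⟩
      · rw [h0, hz]; rfl
      · rw [hφ _ _ _ hw, h0, ih w (h.node_lt _ _ _ hw).2 y hy, hR _ _ hR']; rfl
  have := h.ev_of_val h0 hφ p hG
  rwa [hφ _ _ _ hp, h0, key v _ hv, hd] at this

theorem ev_of_chain (h : FinAx rs D) [Finite A] {m : ℕ} (k : ℕ → A) (hk0 : k 0 = D.g) (hm : k m = D.l)
    (hk : ∀ i < m, D.node D.l (k (i + 1)) (k i)) : Ev rs (.num m) := by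
  obtain ⟨φ, h0, hφ⟩ := h.exists_val
  have key : ∀ i ≤ m, φ (k (m - i)) = .num i := by
    intro i
    induction i with
    | zero => intro _; rw [Nat.sub_zero, hm, h0]; rfl
    | succ i ih =>
      intro hi
      have := hk (m - (i + 1)) (by omega)
      rw [show m - (i + 1) + 1 = m - i by omega] at this
      rw [hφ _ _ _ this, h0, ih (by omega)]; rfl
  have := h.ev_of_val h0 hφ _ h.goal
  rwa [← hk0, ← Nat.sub_self m, key m le_rfl] at this

end FinAx
/-! ### Tree models of the axioms -/

/-- Trees produced in at most `k` steps through trees of size at most `N`. -/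
def EvB (rs : List Rule) (N : ℕ) : ℕ → Tr → Prop
  | 0, t => t = .leaf
  | k + 1, t => t = .leaf ∨ ∃ r ∈ rs, ∃ s : Fin 6 → Tr, t = r.1.sub s ∧
      (r.2.1.sub s).size ≤ N ∧ (r.2.2.sub s).size ≤ N ∧
      EvB rs N k (r.2.1.sub s) ∧ EvB rs N k (r.2.2.sub s)

theorem EvB.mono {rs : List Rule} {N N' k k' : ℕ} (hN : N ≤ N') (hk : k ≤ k') {t : Tr}
    (h : EvB rs N k t) : EvB rs N' k' t := by
  induction k' generalizing k t with
  | zero =>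
    obtain rfl : k = 0 := Nat.le_zero.1 hk
    exact h
  | succ k' ih =>
    cases k with
    | zero => exact Or.inl h
    | succ k =>
      rcases h with h | ⟨r, hr, s, h1, h2, h3, h4, h5⟩
      · exact Or.inl h
      · exact Or.inr ⟨r, hr, s, h1, h2.trans hN, h3.trans hN,
          ih (Nat.le_of_succ_le_succ hk) h4, ih (Nat.le_of_succ_le_succ hk) h5⟩

theorem exists_evB {rs : List Rule} {t : Tr} (h : Ev rs t) : ∃ N, EvB rs N N t := by
  induction h with
  | base => exact ⟨0, rfl⟩
  | step r hr s _ _ ih1 ih2 =>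
    obtain ⟨N1, h1⟩ := ih1
    obtain ⟨N2, h2⟩ := ih2
    refine ⟨N1 + N2 + (r.2.1.sub s).size + (r.2.2.sub s).size + 1, Or.inr ⟨r, hr, s, rfl,
      by omega, by omega, h1.mono (by omega) (by omega), h2.mono (by omega) (by omega)⟩⟩

/-- The elements of the path. -/
def pathElt (i : ℕ) : Tr := .node (.node .leaf .leaf) (.num i)

theorem pathElt_injective : Function.Injective pathElt :=
  fun _ _ h => Tr.num_injective (Tr.node.inj h).2

theorem pathElt_ne_num (i j : ℕ) : pathElt i ≠ .num j := by
  intro h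
  cases j with
  | zero => cases h
  | succ j => cases (Tr.node.inj h).1

/-- The data on a type of trees, with a path of length `n`. -/
def treeData {A : Type u} (φ : A → Tr) (l z d g : A) (n : ℕ) (G : Tr → Prop) (rk : Tr → ℕ) :
    Data A where
  l := l
  z := z
  d := d
  g := g
  node x y w := φ w = .node (φ x) (φ y)
  G x := G (φ x)
  R x y := ∃ i < n, φ x = pathElt i ∧ φ y = pathElt (i + 1)
  V x v := ∃ i ≤ n, φ x = pathElt i ∧ φ v = .num i
  lt₁ x y := (φ x).size < (φ y).size
  lt₂ x y := rk (φ x) < rk (φ y)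

theorem infAx_treeData {rs : List Rule} {A : Type u} {φ : A → Tr} (hφ : Function.Bijective φ)
    {l z d g : A} {m n : ℕ} (hl : φ l = .leaf) (hz : φ z = pathElt 0) (hd : φ d = pathElt n)
    (hg : φ g = .num m) (hm : ¬ Ev rs (.num m)) (hn : ¬ Ev rs (.num (n + 1))) :
    InfAx rs (treeData φ l z d g n (Ev rs) fun _ => 0) where
  node_ex x y := hφ.2 _
  node_fun x y w w' h h' := hφ.1 (h.trans h'.symm)
  base := by
    change Ev rs (φ l)
    rw [hl]
    exact .base
  rule r hr s p q q' hp hq hq' h h' := by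
    have key : ∀ (P : Pat 6) a, P.Mat _ s a → _ := fun P =>
      FinAx.eq_sub_of_mat (D := treeData φ l z d g n (Ev rs) fun _ => 0) (f := φ) hl
        (fun _ _ _ h => h) s P
    change Ev rs (φ p)
    change Ev rs (φ q) at h
    change Ev rs (φ q') at h'
    rw [key _ _ hp]
    rw [key _ _ hq] at h
    rw [key _ _ hq'] at h'
    exact .step r hr _ h h'
  start := ⟨0, Nat.zero_le _, hz, hl⟩
  path := by
    rintro x v ⟨i, hi, hx, hv⟩
    rcases hi.eq_or_lt with rfl | hi
    · exact .inl (hφ.1 (hx.trans hd.symm))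
    · obtain ⟨y, hy⟩ := hφ.2 (pathElt (i + 1))
      obtain ⟨w, hw⟩ := hφ.2 (.num (i + 1))
      refine .inr ⟨y, w, ⟨i, hi, hx, hy⟩, ⟨i + 1, hi, hy, hw⟩, ?_⟩
      change φ w = .node (φ l) (φ v)
      rw [hw, hl, hv]; rfl
  finish_not := by
    rintro v p ⟨i, hi, hx, hv⟩ hp h
    change φ p = .node (φ l) (φ v) at hp
    obtain rfl : n = i := pathElt_injective (hd.symm.trans hx)
    rw [hl, hv] at hp
    refine hn ?_
    change Ev rs (φ p) at h
    rwa [hp] at h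
  goal_not := by
    change ¬ Ev rs (φ g)
    rwa [hg]

theorem mat_treeData {A : Type u} {φ : A → Tr} (hφ : Function.Injective φ) {N : ℕ}
    (hN : ∀ t, (∃ a, φ a = t) ↔ t.size ≤ N) {l z d g : A} (hl : φ l = .leaf) (n : ℕ)
    (G : Tr → Prop) (rk : Tr → ℕ) {k : ℕ} {s : Fin k → Tr} {s' : Fin k → A}
    (hs : ∀ i, (s i).size ≤ N → φ (s' i) = s i) (P : Pat k) :
    ∀ a, φ a = P.sub s → P.Mat (treeData φ l z d g n G rk) s' a := by
  induction P with
  | var i => exact fun a ha => hφ (ha.trans (hs i ((hN _).1 ⟨a, ha⟩)).symm)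
  | leaf => exact fun a ha => hφ (ha.trans hl.symm)
  | node P Q ihP ihQ =>
    intro a ha
    have h := (hN _).1 ⟨a, ha⟩
    obtain ⟨b, hb⟩ := (hN (P.sub s)).2 ((Tr.size_left_lt _ (Q.sub s)).le.trans h)
    obtain ⟨c, hc⟩ := (hN (Q.sub s)).2 ((Tr.size_right_lt (P.sub s) _).le.trans h)
    refine ⟨b, c, ihP b hb, ihQ c hc, ?_⟩
    change φ a = .node (φ b) (φ c)
    rw [ha, hb, hc]; rfl

theorem finAx_treeData {rs : List Rule} {A : Type u} {φ : A → Tr} (hφ : Function.Injective φ)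
    {N : ℕ} (hN : ∀ t, (∃ a, φ a = t) ↔ t.size ≤ N)
    {l z d g : A} {m n k : ℕ} (hl : φ l = .leaf) (hz : φ z = pathElt 0) (hd : φ d = pathElt n)
    (hg : φ g = .num m) (hm : EvB rs N k (.num m)) (hn : EvB rs N k (.num (n + 1)))
    (hnN : n + 2 ≤ N) :
    FinAx rs (treeData φ l z d g n (fun t => ∃ k, EvB rs N k t)
      fun t => sInf {k | EvB rs N k t}) where
  irrefl₁ _ := lt_irrefl _
  irrefl₂ _ := lt_irrefl _
  trans₁ _ _ _ := lt_trans
  trans₂ _ _ _ := lt_trans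
  node_lt x y w h := by
    change φ w = .node (φ x) (φ y) at h
    change (φ x).size < (φ w).size ∧ (φ y).size < (φ w).size
    rw [h]
    exact ⟨Tr.size_left_lt _ _, Tr.size_right_lt _ _⟩
  node_inj x y x' y' w h h' := by
    obtain ⟨h1, h2⟩ := Tr.node.inj (h.symm.trans h')
    exact ⟨hφ h1, hφ h2⟩
  node_ne x y h := by
    have := hl.symm.trans h
    cases this
  rule p hp := by
    obtain ⟨r, hr⟩ : ∃ r, r = sInf {k | EvB rs N k (φ p)} := ⟨_, rfl⟩
    have h : EvB rs N r (φ p) := by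
      rw [hr]; exact Nat.sInf_mem hp
    cases r with
    | zero => exact .inl (hφ (Eq.trans h hl.symm))
    | succ r =>
      rcases h with h | ⟨ru, hru, s, h1, h2, h3, h4, h5⟩
      · exact .inl (hφ (Eq.trans h hl.symm))
      · right
        have hs : ∀ i, ∃ a, (s i).size ≤ N → φ a = s i := by
          intro i
          by_cases hi : (s i).size ≤ N
          · obtain ⟨a, ha⟩ := (hN _).2 hi
            exact ⟨a, fun _ => ha⟩
          · exact ⟨l, fun h => absurd h hi⟩
        choose s' hs' using hs
        obtain ⟨q, hq⟩ := (hN _).2 h2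
        obtain ⟨q', hq'⟩ := (hN _).2 h3
        refine ⟨ru, hru, s', q, q', mat_treeData hφ hN hl n _ _ hs' _ _ h1,
          mat_treeData hφ hN hl n _ _ hs' _ _ hq, mat_treeData hφ hN hl n _ _ hs' _ _ hq',
          ⟨r, hq ▸ h4⟩, ⟨r, hq' ▸ h5⟩, ?_, ?_⟩
        · change sInf {k | EvB rs N k (φ q)} < sInf {k | EvB rs N k (φ p)}
          rw [← hr, hq]
          exact Nat.lt_succ_of_le (Nat.sInf_le h4)
        · change sInf {k | EvB rs N k (φ q')} < sInf {k | EvB rs N k (φ p)}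
          rw [← hr, hq']
          exact Nat.lt_succ_of_le (Nat.sInf_le h5)
  path := by
    rintro x v ⟨i, hi, hx, hv⟩
    cases i with
    | zero => exact .inl ⟨hφ (hx.trans hz.symm), hφ (Eq.trans hv hl.symm)⟩
    | succ i =>
      have hxN := (hN _).1 ⟨x, hx⟩
      simp only [pathElt, Tr.size, Tr.size_num] at hxN
      obtain ⟨y, hy⟩ := (hN (pathElt i)).2 (by simp only [pathElt, Tr.size, Tr.size_num]; omega)
      obtain ⟨w, hw⟩ := (hN (.num i)).2 (by simp only [Tr.size_num]; omega)
      refine .inr ⟨y, w, ⟨i, hi, hy, hx⟩, ⟨i, by omega, hy, hw⟩, ?_⟩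
      change φ v = .node (φ l) (φ w)
      rw [hw, hl, hv]; rfl
  finish := by
    obtain ⟨v, hv⟩ := (hN (.num n)).2 (by simp only [Tr.size_num]; omega)
    obtain ⟨p, hp⟩ := (hN (.num (n + 1))).2 (by simp only [Tr.size_num]; omega)
    refine ⟨v, p, ⟨n, le_rfl, hd, hv⟩, ?_, ⟨k, hp ▸ hn⟩⟩
    change φ p = .node (φ l) (φ v)
    rw [hl, hv, hp]; rfl
  goal := ⟨k, hg ▸ hm⟩

/-- The position on the path. -/
noncomputable def pathPos (t : Tr) : ℕ := sSup {i | t = pathElt i}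

theorem pathPos_pathElt (i : ℕ) : pathPos (pathElt i) = i := by
  have : {j | pathElt i = pathElt j} = {i} := by
    ext j
    exact ⟨fun h => (pathElt_injective h).symm, fun h => congrArg pathElt (Eq.symm h)⟩
  rw [pathPos, this, csSup_singleton]

theorem pathPos_num (j : ℕ) : pathPos (.num j) = 0 := by
  have : {i | Tr.num j = pathElt i} = ∅ := by
    ext i
    exact ⟨fun h => pathElt_ne_num i j (Eq.symm h), fun h => h.elim⟩
  rw [pathPos, this]; simp

/-! ### The axioms as first-order sentences -/

/-- The signature of the axioms. -/
def baseSig : Signature where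
  consts := {0, 1, 2, 3}
  preds := {(0, 3), (1, 1), (2, 2), (3, 2), (4, 2), (5, 2)}
  consts_nonempty := ⟨0, by decide⟩

/-- The data of a structure. -/
def Str.data (A : Str.{u} baseSig) : Data A where
  l := A.const 0 (by decide)
  z := A.const 1 (by decide)
  d := A.const 2 (by decide)
  g := A.const 3 (by decide)
  node x y w := A.pred 0 3 (by decide) ![x, y, w]
  G x := A.pred 1 1 (by decide) ![x]
  R x y := A.pred 2 2 (by decide) ![x, y]
  V x y := A.pred 3 2 (by decide) ![x, y]
  lt₁ x y := A.pred 4 2 (by decide) ![x, y]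
  lt₂ x y := A.pred 5 2 (by decide) ![x, y]

/-- A property of assignments in structures that is uniformly first-order definable. -/
def UDef {τ : Signature} (Γ : Type) (X : ∀ A : Str.{u} τ, (Γ → A) → Prop) : Prop :=
  ∃ φ : τ.lang.Formula Γ, ∀ A v, φ.Realize v ↔ X A v

/-- A function of assignments in structures that is given by a term. -/
def UTerm {τ : Signature} (Γ : Type) (X : ∀ A : Str.{u} τ, (Γ → A) → A) : Prop :=
  ∃ t : τ.lang.Term Γ, ∀ A v, t.realize v = X A v

section UDef

variable {τ : Signature} {Γ : Type}

theorem UTerm.var (i : Γ) : UTerm (τ := τ) Γ fun _ v => v i := ⟨.var i, fun _ _ => rfl⟩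

theorem UTerm.const (c : ℕ) (hc : c ∈ τ.consts) : UTerm (τ := τ) Γ fun A _ => A.const c hc :=
  ⟨Language.Term.func (L := τ.lang) (l := 0) (.const c hc) Fin.elim0, fun _ _ =>
    congrArg (Language.Structure.funMap (L := τ.lang) (n := 0) (Signature.Fn.const c hc))
      (Subsingleton.elim _ _)⟩

theorem UDef.eq {X Y : ∀ A : Str.{u} τ, (Γ → A) → A} (hX : UTerm Γ X) (hY : UTerm Γ Y) :
    UDef Γ fun A v => X A v = Y A v := by
  obtain ⟨s, hs⟩ := hX
  obtain ⟨t, ht⟩ := hY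
  exact ⟨s.equal t, fun A v => by rw [Language.Formula.realize_equal, hs, ht]⟩

theorem UDef.pred {P k : ℕ} (hP : (P, k) ∈ τ.preds) {X : Fin k → ∀ A : Str.{u} τ, (Γ → A) → A}
    (hX : ∀ i, UTerm Γ (X i)) : UDef Γ fun A v => A.pred P k hP fun i => X i A v := by
  choose t ht using hX
  refine ⟨Language.Relations.formula (L := τ.lang) (n := k) ⟨P, hP⟩ t, fun A v => ?_⟩
  refine Language.Formula.realize_rel.trans ?_
  simp only [ht]
  rfl

theorem UDef.pred₁ {P : ℕ} (hP : (P, 1) ∈ τ.preds) {X : ∀ A : Str.{u} τ, (Γ → A) → A}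
    (hX : UTerm Γ X) : UDef Γ fun A v => A.pred P 1 hP ![X A v] := by
  obtain ⟨φ, hφ⟩ := UDef.pred hP (X := ![X]) (by simpa [Fin.forall_fin_succ] using hX)
  refine ⟨φ, fun A v => (hφ A v).trans (iff_of_eq (congrArg _ (funext fun i => ?_)))⟩
  fin_cases i; rfl

theorem UDef.pred₂ {P : ℕ} (hP : (P, 2) ∈ τ.preds) {X Y : ∀ A : Str.{u} τ, (Γ → A) → A}
    (hX : UTerm Γ X) (hY : UTerm Γ Y) : UDef Γ fun A v => A.pred P 2 hP ![X A v, Y A v] := by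
  obtain ⟨φ, hφ⟩ := UDef.pred hP (X := ![X, Y]) (by simpa [Fin.forall_fin_succ] using ⟨hX, hY⟩)
  refine ⟨φ, fun A v => (hφ A v).trans (iff_of_eq (congrArg _ (funext fun i => ?_)))⟩
  fin_cases i <;> rfl

theorem UDef.pred₃ {P : ℕ} (hP : (P, 3) ∈ τ.preds) {X Y Z : ∀ A : Str.{u} τ, (Γ → A) → A}
    (hX : UTerm Γ X) (hY : UTerm Γ Y) (hZ : UTerm Γ Z) :
    UDef Γ fun A v => A.pred P 3 hP ![X A v, Y A v, Z A v] := by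
  obtain ⟨φ, hφ⟩ := UDef.pred hP (X := ![X, Y, Z])
    (by simpa [Fin.forall_fin_succ] using ⟨hX, hY, hZ⟩)
  refine ⟨φ, fun A v => (hφ A v).trans (iff_of_eq (congrArg _ (funext fun i => ?_)))⟩
  fin_cases i <;> rfl

theorem UDef.false : UDef (τ := τ) Γ fun _ _ => False := ⟨⊥, fun _ _ => Iff.rfl⟩

theorem UDef.imp {X Y : ∀ A : Str.{u} τ, (Γ → A) → Prop} (hX : UDef Γ X) (hY : UDef Γ Y) :
    UDef Γ fun A v => X A v → Y A v := by
  obtain ⟨φ, hφ⟩ := hX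
  obtain ⟨ψ, hψ⟩ := hY
  exact ⟨φ.imp ψ, fun A v => by rw [Language.Formula.realize_imp, hφ, hψ]⟩

theorem UDef.not {X : ∀ A : Str.{u} τ, (Γ → A) → Prop} (hX : UDef Γ X) :
    UDef Γ fun A v => ¬ X A v := hX.imp .false

theorem UDef.and {X Y : ∀ A : Str.{u} τ, (Γ → A) → Prop} (hX : UDef Γ X) (hY : UDef Γ Y) :
    UDef Γ fun A v => X A v ∧ Y A v := by
  obtain ⟨φ, hφ⟩ := hX
  obtain ⟨ψ, hψ⟩ := hY
  exact ⟨φ ⊓ ψ, fun A v => by rw [Language.Formula.realize_inf, hφ, hψ]⟩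

theorem UDef.or {X Y : ∀ A : Str.{u} τ, (Γ → A) → Prop} (hX : UDef Γ X) (hY : UDef Γ Y) :
    UDef Γ fun A v => X A v ∨ Y A v := by
  obtain ⟨φ, hφ⟩ := hX
  obtain ⟨ψ, hψ⟩ := hY
  exact ⟨φ ⊔ ψ, fun A v => by rw [Language.Formula.realize_sup, hφ, hψ]⟩

theorem UDef.forall_fun {β : Type} [Finite β] {X : ∀ A : Str.{u} τ, (Γ → A) → (β → A) → Prop}
    (hX : UDef (Γ ⊕ β) fun A v => X A (fun i => v (.inl i)) fun i => v (.inr i)) :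
    UDef Γ fun A v => ∀ s, X A v s := by
  obtain ⟨φ, hφ⟩ := hX
  exact ⟨φ.iAlls β, fun A v => by simp only [Language.Formula.realize_iAlls, hφ]; rfl⟩

theorem UDef.exists_fun {β : Type} [Finite β] {X : ∀ A : Str.{u} τ, (Γ → A) → (β → A) → Prop}
    (hX : UDef (Γ ⊕ β) fun A v => X A (fun i => v (.inl i)) fun i => v (.inr i)) :
    UDef Γ fun A v => ∃ s, X A v s := by
  obtain ⟨φ, hφ⟩ := hX
  exact ⟨φ.iExs β, fun A v => by simp only [Language.Formula.realize_iExs, hφ]; rfl⟩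

theorem UDef.of_iff {X Y : ∀ A : Str.{u} τ, (Γ → A) → Prop} (hX : UDef Γ X)
    (h : ∀ A v, X A v ↔ Y A v) : UDef Γ Y := by
  obtain ⟨φ, hφ⟩ := hX
  exact ⟨φ, fun A v => (hφ A v).trans (h A v)⟩

theorem UDef.all {X : ∀ A : Str.{u} τ, (Γ → A) → A → Prop}
    (hX : UDef (Γ ⊕ Unit) fun A v => X A (fun i => v (.inl i)) (v (.inr ()))) :
    UDef Γ fun A v => ∀ a, X A v a :=
  (UDef.forall_fun (X := fun A v s => X A v (s ())) hX).of_iff fun _ _ =>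
    ⟨fun h a => h fun _ => a, fun h _ => h _⟩

theorem UDef.ex {X : ∀ A : Str.{u} τ, (Γ → A) → A → Prop}
    (hX : UDef (Γ ⊕ Unit) fun A v => X A (fun i => v (.inl i)) (v (.inr ()))) :
    UDef Γ fun A v => ∃ a, X A v a :=
  (UDef.exists_fun (X := fun A v s => X A v (s ())) hX).of_iff fun _ _ =>
    ⟨fun ⟨_, h⟩ => ⟨_, h⟩, fun ⟨a, h⟩ => ⟨fun _ => a, h⟩⟩

theorem UDef.forall_mem {ι : Type} (l : List ι) {X : ι → ∀ A : Str.{u} τ, (Γ → A) → Prop}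
    (hX : ∀ i, UDef Γ (X i)) : UDef Γ fun A v => ∀ i ∈ l, X i A v := by
  induction l with
  | nil => exact UDef.false.not.of_iff fun A v => by simp
  | cons i l ih => exact ((hX i).and ih).of_iff fun A v => by simp

theorem UDef.exists_mem {ι : Type} (l : List ι) {X : ι → ∀ A : Str.{u} τ, (Γ → A) → Prop}
    (hX : ∀ i, UDef Γ (X i)) : UDef Γ fun A v => ∃ i ∈ l, X i A v := by
  induction l with
  | nil => exact UDef.false.of_iff fun A v => by simp
  | cons i l ih => exact ((hX i).or ih).of_iff fun A v => by simp

/-- A definable property of structures is given by a sentence. -/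
theorem UDef.exists_sentence {X : Str.{u} τ → Prop} (hX : UDef Empty fun A _ => X A) :
    ∃ Φ : τ.lang.Sentence, ∀ A : Str.{u} τ, A ⊨ Φ ↔ X A := by
  obtain ⟨φ, hφ⟩ := hX
  exact ⟨φ, fun A => hφ A _⟩

end UDef

theorem UDef.mat {Γ : Type} {k : ℕ} {S : Fin k → ∀ A : Str.{u} baseSig, (Γ → A) → A}
    (hS : ∀ i, UTerm Γ (S i)) (P : Pat k) {X : ∀ A : Str.{u} baseSig, (Γ → A) → A}
    (hX : UTerm Γ X) : UDef Γ fun A v => P.Mat A.data (fun i => S i A v) (X A v) := by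
  induction P generalizing Γ with
  | var i => exact UDef.eq hX (hS i)
  | leaf => exact UDef.eq hX (.const 0 _)
  | node P Q ihP ihQ =>
    have lift : ∀ {Γ' β : Type} {Y : ∀ A : Str.{u} baseSig, (Γ' → A) → A}, UTerm Γ' Y →
        UTerm (Γ' ⊕ β) fun A v => Y A fun i => v (.inl i) := by
      rintro Γ' β Y ⟨t, ht⟩
      exact ⟨t.relabel Sum.inl, fun A v => by rw [Language.Term.realize_relabel, ht]; rfl⟩
    refine UDef.ex (UDef.ex (UDef.and ?_ (UDef.and ?_ ?_)))
    · exact ihP (fun i => lift (lift (hS i))) (.var (Sum.inl (Sum.inr ())))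
    · exact ihQ (fun i => lift (lift (hS i))) (.var (Sum.inr ()))
    · exact UDef.pred₃ _ (.var (Sum.inl (Sum.inr ()))) (.var (Sum.inr ())) (lift (lift hX))

section Data

variable {Γ : Type} {X Y Z : ∀ A : Str.{u} baseSig, (Γ → A) → A}

theorem UTerm.data_l : UTerm Γ fun (A : Str.{u} baseSig) _ => A.data.l := .const 0 _

theorem UTerm.data_z : UTerm Γ fun (A : Str.{u} baseSig) _ => A.data.z := .const 1 _

theorem UTerm.data_d : UTerm Γ fun (A : Str.{u} baseSig) _ => A.data.d := .const 2 _

theorem UTerm.data_g : UTerm Γ fun (A : Str.{u} baseSig) _ => A.data.g := .const 3 _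

theorem UDef.data_node (hX : UTerm Γ X) (hY : UTerm Γ Y) (hZ : UTerm Γ Z) :
    UDef Γ fun A v => A.data.node (X A v) (Y A v) (Z A v) := .pred₃ _ hX hY hZ

theorem UDef.data_G (hX : UTerm Γ X) : UDef Γ fun A v => A.data.G (X A v) := .pred₁ _ hX

theorem UDef.data_R (hX : UTerm Γ X) (hY : UTerm Γ Y) :
    UDef Γ fun A v => A.data.R (X A v) (Y A v) := .pred₂ _ hX hY

theorem UDef.data_V (hX : UTerm Γ X) (hY : UTerm Γ Y) :
    UDef Γ fun A v => A.data.V (X A v) (Y A v) := .pred₂ _ hX hY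

theorem UDef.data_lt₁ (hX : UTerm Γ X) (hY : UTerm Γ Y) :
    UDef Γ fun A v => A.data.lt₁ (X A v) (Y A v) := .pred₂ _ hX hY

theorem UDef.data_lt₂ (hX : UTerm Γ X) (hY : UTerm Γ Y) :
    UDef Γ fun A v => A.data.lt₂ (X A v) (Y A v) := .pred₂ _ hX hY

end Data

theorem infAx_iff (rs : List Rule) {A : Type u} (D : Data A) : InfAx rs D ↔
    (∀ x y, ∃ w, D.node x y w) ∧
    (∀ x y w w', D.node x y w → D.node x y w' → w = w') ∧
    D.G D.l ∧
    (∀ r ∈ rs, ∀ s : Fin 6 → A, ∀ p q q', r.1.Mat D (fun i => s i) p →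
      r.2.1.Mat D (fun i => s i) q → r.2.2.Mat D (fun i => s i) q' → D.G q → D.G q' → D.G p) ∧
    D.V D.z D.l ∧
    (∀ x v, D.V x v → x = D.d ∨ ∃ y w, D.R x y ∧ D.V y w ∧ D.node D.l v w) ∧
    (∀ v p, D.V D.d v → D.node D.l v p → ¬ D.G p) ∧
    ¬ D.G D.g :=
  ⟨fun ⟨h1, h2, h3, h4, h5, h6, h7, h8⟩ => ⟨h1, h2, h3, h4, h5, h6, h7, h8⟩,
    fun ⟨h1, h2, h3, h4, h5, h6, h7, h8⟩ => ⟨h1, h2, h3, h4, h5, h6, h7, h8⟩⟩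

theorem finAx_iff (rs : List Rule) {A : Type u} (D : Data A) : FinAx rs D ↔
    (∀ x, ¬ D.lt₁ x x) ∧ (∀ x, ¬ D.lt₂ x x) ∧
    (∀ x y w, D.lt₁ x y → D.lt₁ y w → D.lt₁ x w) ∧
    (∀ x y w, D.lt₂ x y → D.lt₂ y w → D.lt₂ x w) ∧
    (∀ x y w, D.node x y w → D.lt₁ x w ∧ D.lt₁ y w) ∧
    (∀ x y x' y' w, D.node x y w → D.node x' y' w → x = x' ∧ y = y') ∧
    (∀ x y, ¬ D.node x y D.l) ∧
    (∀ p, D.G p → p = D.l ∨ ∃ r ∈ rs, ∃ s : Fin 6 → A, ∃ q q', r.1.Mat D (fun i => s i) p ∧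
      r.2.1.Mat D (fun i => s i) q ∧ r.2.2.Mat D (fun i => s i) q' ∧
      D.G q ∧ D.G q' ∧ D.lt₂ q p ∧ D.lt₂ q' p) ∧
    (∀ x v, D.V x v → (x = D.z ∧ v = D.l) ∨ ∃ y w, D.R y x ∧ D.V y w ∧ D.node D.l w v) ∧
    (∃ v p, D.V D.d v ∧ D.node D.l v p ∧ D.G p) ∧
    D.G D.g :=
  ⟨fun ⟨h1, h2, h3, h4, h5, h6, h7, h8, h9, h10, h11⟩ =>
      ⟨h1, h2, h3, h4, h5, h6, h7, h8, h9, h10, h11⟩,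
    fun ⟨h1, h2, h3, h4, h5, h6, h7, h8, h9, h10, h11⟩ =>
      ⟨h1, h2, h3, h4, h5, h6, h7, h8, h9, h10, h11⟩⟩

theorem exists_sentence_infAx (rs : List Rule) :
    ∃ Φ : baseSig.lang.Sentence, ∀ A : Str.{u} baseSig, A ⊨ Φ ↔ InfAx rs A.data := by
  simp only [infAx_iff]
  apply UDef.exists_sentence
  repeat' first
    | apply UTerm.data_l | apply UTerm.data_z | apply UTerm.data_d | apply UTerm.data_g
    | apply UTerm.var
    | apply UDef.data_node | apply UDef.data_G | apply UDef.data_R | apply UDef.data_V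
    | apply UDef.eq | apply UDef.mat
    | apply UDef.not | apply UDef.and | apply UDef.or
    | (apply UDef.forall_mem; intro r)
    | apply UDef.imp
    | apply UDef.all | apply UDef.ex | apply UDef.forall_fun
    | intro i

theorem exists_sentence_finAx (rs : List Rule) :
    ∃ Φ : baseSig.lang.Sentence, ∀ A : Str.{u} baseSig, A ⊨ Φ ↔ FinAx rs A.data := by
  simp only [finAx_iff]
  apply UDef.exists_sentence
  repeat' first
    | apply UTerm.data_l | apply UTerm.data_z | apply UTerm.data_d | apply UTerm.data_g
    | apply UTerm.var
    | apply UDef.data_node | apply UDef.data_G | apply UDef.data_R | apply UDef.data_V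
    | apply UDef.data_lt₁ | apply UDef.data_lt₂
    | apply UDef.eq | apply UDef.mat
    | apply UDef.not | apply UDef.and | apply UDef.or
    | (apply UDef.exists_mem; intro r)
    | apply UDef.imp
    | apply UDef.all | apply UDef.ex | apply UDef.exists_fun
    | intro i

/-! ### Sentences with a numeral as parameter -/

theorem termCode_onTerm {σ τ : Signature} (h : σ ≤ τ) {n : ℕ} (t : σ.lang.Term (Empty ⊕ Fin n)) :
    termCode ((Signature.incl h).onTerm t) = termCode t := by
  rcases t with (i | i) | ⟨⟨c, hc⟩, ts⟩
  · exact i.elim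
  · rfl
  · rfl

theorem formulaCode_onBoundedFormula {σ τ : Signature} (h : σ ≤ τ) {n : ℕ}
    (φ : σ.lang.BoundedFormula Empty n) :
    formulaCode ((Signature.incl h).onBoundedFormula φ) = formulaCode φ := by
  induction φ with
  | falsum => rfl
  | equal t s =>
    change Nat.pair 1 (Nat.pair (termCode ((Signature.incl h).onTerm t))
      (termCode ((Signature.incl h).onTerm s))) = _
    rw [termCode_onTerm, termCode_onTerm]
    rfl
  | rel R ts =>
    change Nat.pair 2 (Nat.pair R.1 (Encodable.encode (List.ofFn fun i =>
      termCode ((Signature.incl h).onTerm (ts i))))) = _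
    simp only [termCode_onTerm]
    rfl
  | imp φ ψ ihφ ihψ => exact congrArg (Nat.pair 3) (congrArg₂ Nat.pair ihφ ihψ)
  | all φ ih => exact congrArg (Nat.pair 4) ih

/-- A constant as a term. -/
def constTerm {τ : Signature} (c : ℕ) (hc : c ∈ τ.consts) : τ.lang.Term (Empty ⊕ Fin 0) :=
  Language.Term.func (L := τ.lang) (l := 0) (.const c hc) Fin.elim0

theorem realize_constTerm {τ : Signature} {c : ℕ} (hc : c ∈ τ.consts) (A : Str.{u} τ)
    (v : Empty ⊕ Fin 0 → A) : (constTerm c hc).realize v = A.const c hc :=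
  congrArg (Language.Structure.funMap (L := τ.lang) (n := 0) (Signature.Fn.const c hc))
    (Subsingleton.elim _ _)

/-- The sentence `node a b c` for constants `a`, `b` and `c`. -/
def nodeSentence {τ : Signature} (hP : (0, 3) ∈ τ.preds) {a b c : ℕ} (ha : a ∈ τ.consts)
    (hb : b ∈ τ.consts) (hc : c ∈ τ.consts) : τ.lang.Sentence :=
  Language.BoundedFormula.rel (L := τ.lang) (l := 3) ⟨0, hP⟩
    ![constTerm a ha, constTerm b hb, constTerm c hc]

theorem realize_nodeSentence {τ : Signature} (hP : (0, 3) ∈ τ.preds) {a b c : ℕ}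
    (ha : a ∈ τ.consts) (hb : b ∈ τ.consts) (hc : c ∈ τ.consts) (A : Str.{u} τ) :
    A ⊨ nodeSentence hP ha hb hc ↔ A.pred 0 3 hP ![A.const a ha, A.const b hb, A.const c hc] := by
  refine iff_of_eq (congrArg (A.pred 0 3 hP) (funext fun i => ?_))
  fin_cases i <;> exact realize_constTerm _ A _

/-- The implication from the statements that the constants `3 + j, …, 3` are successive numerals
to `X`. -/
def chainSentence {τ : Signature} (hP : (0, 3) ∈ τ.preds) (X : τ.lang.Sentence) :
    ∀ j : ℕ, (∀ i < j + 4, i ∈ τ.consts) → τ.lang.Sentence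
  | 0, _ => X
  | j + 1, hc => (nodeSentence (a := 0) (b := j + 4) (c := j + 3) hP (hc _ (by omega))
      (hc _ (by omega)) (hc _ (by omega))).imp
      (chainSentence hP X j fun i hi => hc i (by omega))

theorem realize_chainSentence {τ : Signature} (hP : (0, 3) ∈ τ.preds) (X : τ.lang.Sentence)
    (j : ℕ) (hc : ∀ i < j + 4, i ∈ τ.consts) (A : Str.{u} τ) :
    A ⊨ chainSentence hP X j hc ↔ ((∀ i (hi : i < j), A.pred 0 3 hP
      ![A.const 0 (hc _ (by omega)), A.const (i + 4) (hc _ (by omega)),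
        A.const (i + 3) (hc _ (by omega))]) → A ⊨ X) := by
  induction j with
  | zero => exact ⟨fun h _ => h, fun h => h fun i hi => absurd hi (Nat.not_lt_zero i)⟩
  | succ j ih =>
    have e : A ⊨ chainSentence hP X (j + 1) hc ↔ (A ⊨ nodeSentence (a := 0) (b := j + 4)
        (c := j + 3) hP (hc _ (by omega)) (hc _ (by omega)) (hc _ (by omega)) →
        A ⊨ chainSentence hP X j fun i hi => hc i (by omega)) := Iff.rfl
    rw [e, realize_nodeSentence, ih]
    constructor
    · exact fun h H => h (H j (Nat.lt_succ_self j)) fun i hi => H i (Nat.lt_succ_of_lt hi)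
    · intro h h1 h2
      refine h fun i hi => ?_
      rcases (Nat.lt_succ_iff.1 hi).eq_or_lt with rfl | hi
      · exact h1
      · exact h2 i hi

/-- The code of `chainSentence`. -/
def chainCode (x : ℕ) : ℕ → ℕ
  | 0 => x
  | j + 1 => Nat.pair 3 (Nat.pair (Nat.pair 2 (Nat.pair 0
      (Encodable.encode [1, 2 * (j + 4) + 1, 2 * (j + 3) + 1]))) (chainCode x j))

theorem formulaCode_chainSentence {τ : Signature} (hP : (0, 3) ∈ τ.preds) (X : τ.lang.Sentence)
    (j : ℕ) (hc : ∀ i < j + 4, i ∈ τ.consts) :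
    formulaCode (chainSentence hP X j hc) = chainCode (formulaCode X) j := by
  induction j with
  | zero => rfl
  | succ j ih => exact congrArg (Nat.pair 3) (congrArg₂ Nat.pair rfl (ih _))

/-- The signature of the axioms with constants for the numerals up to `m + 1`, joined with a given
signature. -/
def paramSig (σ : Signature) (m : ℕ) : Signature where
  consts := σ.consts ∪ Finset.range (m + 5)
  preds := σ.preds ∪ baseSig.preds
  consts_nonempty := σ.consts_nonempty.mono Finset.subset_union_left

theorem le_paramSig (σ : Signature) (m : ℕ) : σ ≤ paramSig σ m :=
  ⟨Finset.subset_union_left, Finset.subset_union_left⟩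

theorem mem_paramSig (σ : Signature) {m i : ℕ} (hi : i < m + 5) : i ∈ (paramSig σ m).consts :=
  Finset.mem_union_right _ (Finset.mem_range.2 hi)

theorem baseSig_le_paramSig (σ : Signature) (m : ℕ) : baseSig ≤ paramSig σ m := by
  refine ⟨fun i hi => mem_paramSig σ ?_, Finset.subset_union_right⟩
  have : i < 4 := by
    simp only [baseSig, Finset.mem_insert, Finset.mem_singleton] at hi
    omega
  omega

/-- The conjunction of a sentence `Ψ` and the statement that the distinguished tree `g` of the
axioms is the numeral `m + 1`. -/
def paramSentence (σ : Signature) (Ψ : baseSig.lang.Sentence) (m : ℕ) :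
    (paramSig σ m).lang.Sentence :=
  (chainSentence (τ := paramSig σ m) ((baseSig_le_paramSig σ m).2 (by decide))
    ((Language.BoundedFormula.equal (constTerm (m + 4) (mem_paramSig σ (by omega))) (constTerm 0
      (mem_paramSig σ (by omega)))).imp ((Signature.incl (baseSig_le_paramSig σ m)).onSentence Ψ).not)
    (m + 1) fun _ hi => mem_paramSig σ hi).not

theorem realize_paramSentence (σ : Signature) (Ψ : baseSig.lang.Sentence) (m : ℕ)
    (A : Str.{u} (paramSig σ m)) : A ⊨ paramSentence σ Ψ m ↔
      (∀ i (hi : i < m + 1), A.pred 0 3 ((baseSig_le_paramSig σ m).2 (by decide))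
        ![A.const 0 (mem_paramSig σ (by omega)), A.const (i + 4) (mem_paramSig σ (by omega)),
          A.const (i + 3) (mem_paramSig σ (by omega))]) ∧
      A.const (m + 4) (mem_paramSig σ (by omega)) = A.const 0 (mem_paramSig σ (by omega)) ∧
      (A.reduct (baseSig_le_paramSig σ m)) ⊨ Ψ := by
  let : baseSig.lang.Structure A := (Signature.incl (baseSig_le_paramSig σ m)).reduct A
  have h1 : A ⊨ (Signature.incl (baseSig_le_paramSig σ m)).onSentence Ψ ↔
      (A.reduct (baseSig_le_paramSig σ m)) ⊨ Ψ :=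
    Language.LHom.realize_onSentence A (Signature.incl (baseSig_le_paramSig σ m)) Ψ
  have h2 : A ⊨ (Language.BoundedFormula.equal (constTerm (m + 4) (mem_paramSig σ (by omega)))
      (constTerm 0 (mem_paramSig σ (by omega))) : (paramSig σ m).lang.Sentence) ↔
      A.const (m + 4) (mem_paramSig σ (by omega)) = A.const 0 (mem_paramSig σ (by omega)) := by
    refine iff_of_eq (congrArg₂ Eq ?_ ?_) <;> exact realize_constTerm _ A _
  rw [paramSentence, Language.Sentence.realize_not, realize_chainSentence,
    Language.Sentence.realize_imp, Language.Sentence.realize_not, h1, h2]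
  tauto

/-- The code of `paramSentence`. -/
def paramCode (x m : ℕ) : ℕ :=
  Nat.pair 3 (Nat.pair (chainCode (Nat.pair 3 (Nat.pair (Nat.pair 1 (Nat.pair (2 * (m + 4) + 1) 1))
    (Nat.pair 3 (Nat.pair x (Nat.pair 0 0))))) (m + 1)) (Nat.pair 0 0))

theorem formulaCode_paramSentence (σ : Signature) (Ψ : baseSig.lang.Sentence) (m : ℕ) :
    formulaCode (paramSentence σ Ψ m) = paramCode (formulaCode Ψ) m := by
  refine congrArg (Nat.pair 3) (congrArg₂ Nat.pair ?_ rfl)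
  refine (formulaCode_chainSentence _ _ _ _).trans (congrArg (chainCode · (m + 1)) ?_)
  refine congrArg (Nat.pair 3) (congrArg₂ Nat.pair rfl ?_)
  exact congrArg (Nat.pair 3)
    (congrArg₂ Nat.pair (formulaCode_onBoundedFormula (baseSig_le_paramSig σ m) Ψ) rfl)

open Primrec in
theorem primrec_paramCode (x : ℕ) : Primrec (paramCode x) := by
  have hp : Primrec₂ Nat.pair := Primrec₂.natPair
  have hd (k : ℕ) : Primrec fun n : ℕ => 2 * (n + k) + 1 :=
    nat_add.comp (nat_mul.comp (const 2) (nat_add.comp .id (const k))) (const 1)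
  have hl : Primrec fun j : ℕ => Encodable.encode [1, 2 * (j + 4) + 1, 2 * (j + 3) + 1] :=
    Primrec.encode.comp (list_cons.comp (const 1) (list_cons.comp (hd 4)
      (list_cons.comp (hd 3) (const []))))
  have hx : Primrec fun m : ℕ => Nat.pair 3 (Nat.pair (Nat.pair 1 (Nat.pair (2 * (m + 4) + 1) 1))
      (Nat.pair 3 (Nat.pair x (Nat.pair 0 0)))) :=
    hp.comp (const 3) (hp.comp (hp.comp (const 1) (hp.comp (hd 4) (const 1))) (const _))
  have hs : Primrec₂ fun (_ : ℕ) (p : ℕ × ℕ) => Nat.pair 3 (Nat.pair (Nat.pair 2 (Nat.pair 0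
      (Encodable.encode [1, 2 * (p.1 + 4) + 1, 2 * (p.1 + 3) + 1]))) p.2) :=
    hp.comp (const 3) (hp.comp (hp.comp (const 2) (hp.comp (const 0)
      (hl.comp (fst.comp snd)))) (snd.comp snd))
  refine hp.comp (const 3) (hp.comp ((nat_rec' succ hx hs).of_eq fun m => ?_) (const _))
  generalize Nat.pair 3 (Nat.pair (Nat.pair 1 (Nat.pair (2 * (m + 4) + 1) 1))
      (Nat.pair 3 (Nat.pair x (Nat.pair 0 0)))) = y
  rw [Nat.succ_eq_add_one]
  generalize m + 1 = j
  induction j with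
  | zero => rfl
  | succ j ih => simp only [chainCode, ← ih]

/-! ### Structures given by names -/

/-- The structure that interprets the constant symbol `c` by `c` and the predicate symbols with name
`P` by `p P`. -/
def Str.ofInterp (τ : Signature) {A : Type u} (c : ℕ → A) (p : ℕ → List A → Prop) : Str.{u} τ :=
  ⟨A, { funMap := fun {_} f _ => match f with | .const i _ => c i
        RelMap := fun R xs => p R.1 (List.ofFn xs) }⟩

/-- A path of length `n` with ends `1` and `2`, and with all other relations full. -/
def pathStr (τ : Signature) (n : ℕ) : Str.{u} τ :=
  .ofInterp τ (A := ULift.{u} (Fin (n + 1))) (fun c => ⟨if c = 2 then Fin.last n else 0⟩)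
    fun P l => P = 2 → ∀ x y, l = [x, y] → (y.down : ℕ) = x.down + 1

/-- The interpretation of the predicate symbols by given data. -/
def Data.pred {A : Type u} (D : Data A) : ℕ → List A → Prop
  | 0, [x, y, w] => D.node x y w
  | 1, [x] => D.G x
  | 2, [x, y] => D.R x y
  | 3, [x, y] => D.V x y
  | 4, [x, y] => D.lt₁ x y
  | 5, [x, y] => D.lt₂ x y
  | _, _ => False

/-- The interpretation of the constant symbols by given data and a sequence of elements. -/
def Data.const {A : Type u} (D : Data A) (k : ℕ → A) : ℕ → A
  | 0 => D.l
  | 1 => D.z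
  | 2 => D.d
  | i + 3 => k i

/-- The structure with given data. -/
def modelStr (τ : Signature) {A : Type u} (D : Data A) (k : ℕ → A) : Str.{u} τ :=
  .ofInterp τ (D.const k) D.pred

theorem data_modelStr {τ : Signature} (h : baseSig ≤ τ) {A : Type u} (D : Data A) (k : ℕ → A)
    (hk : k 0 = D.g) : ((modelStr τ D k).reduct h).data = D := by
  obtain ⟨l, z, d, g, node, G, R, V, lt₁, lt₂⟩ := D
  obtain rfl : k 0 = g := hk
  rfl

theorem modelStr_realize {σ : Signature} {Ψ : baseSig.lang.Sentence} {m : ℕ} {A : Type u}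
    {D : Data A} {k : ℕ → A} (hk : k 0 = D.g) (hm : k (m + 1) = D.l)
    (hn : ∀ i < m + 1, D.node D.l (k (i + 1)) (k i)) {X : ∀ {A : Type u}, Data A → Prop}
    (hΨ : ∀ A : Str.{u} baseSig, A ⊨ Ψ ↔ X A.data) (hX : X D) :
    modelStr (paramSig σ m) D k ⊨ paramSentence σ Ψ m := by
  rw [realize_paramSentence]
  refine ⟨hn, hm, ?_⟩
  rw [hΨ, data_modelStr _ _ _ hk]
  exact hX

theorem exists_chain {σ : Signature} {Ψ : baseSig.lang.Sentence} {m : ℕ}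
    {A : Str.{u} (paramSig σ m)} (h : A ⊨ paramSentence σ Ψ m) {D : Data A}
    (hD : D = (A.reduct (baseSig_le_paramSig σ m)).data) :
    ∃ k : ℕ → A, k 0 = D.g ∧ k (m + 1) = D.l ∧ ∀ i < m + 1, D.node D.l (k (i + 1)) (k i) := by
  obtain ⟨h1, h2, -⟩ := (realize_paramSentence σ Ψ m A).1 h
  subst hD
  refine ⟨fun i => if hi : i + 3 < m + 5 then A.const (i + 3) (mem_paramSig σ hi) else
    A.const 0 (mem_paramSig σ (by omega)), ?_, ?_, fun i hi => ?_⟩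
  · exact dif_pos (by omega)
  · exact (dif_pos (by omega)).trans h2
  · simp only [show i + 1 + 3 < m + 5 by omega, show i + 3 < m + 5 by omega, dif_pos]
    exact h1 i hi

theorem exists_pathMap {τ : Signature} (h : baseSig ≤ τ) {A : Str.{u} τ} {n : ℕ}
    (f : A →[τ.lang] pathStr.{u} τ n) {D : Data A} (hD : D = (A.reduct h).data) :
    ∃ f : A → ℕ, f D.z = 0 ∧ f D.d = n ∧ ∀ x y, D.R x y → f y = f x + 1 ∧ f x < n := by
  subst hD
  have hc (c : ℕ) (hc : c ∈ τ.consts) : f (A.const c hc) = ⟨if c = 2 then Fin.last n else 0⟩ :=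
    f.map_fun' (n := 0) (Signature.Fn.const c hc) Fin.elim0
  have hR (x y : A) (hxy : ((A.reduct h).data).R x y) :
      ((f y : ULift (Fin (n + 1))).down : ℕ) = (f x : ULift (Fin (n + 1))).down + 1 :=
    f.map_rel' (n := 2) (⟨2, h.2 (by decide)⟩ : τ.Rel 2) ![x, y] hxy rfl _ _ rfl
  refine ⟨fun x => ((f x : ULift (Fin (n + 1))).down : ℕ), ?_, ?_, fun x y hxy => ⟨hR x y hxy, ?_⟩⟩
  · exact congrArg (fun x : ULift (Fin (n + 1)) => (x.down : ℕ)) (hc 1 (h.1 (by decide)))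
  · exact congrArg (fun x : ULift (Fin (n + 1)) => (x.down : ℕ)) (hc 2 (h.1 (by decide)))
  · have := (f y : ULift (Fin (n + 1))).down.isLt
    have := hR x y hxy
    change ((f x : ULift (Fin (n + 1))).down : ℕ) < n
    omega

theorem nonempty_hom_pathStr (τ : Signature) {A : Type u} {φ : A → Tr} {l z d g : A} {n : ℕ}
    (hl : φ l = .leaf) (hz : φ z = pathElt 0) (hd : φ d = pathElt n) (G : Tr → Prop) (rk : Tr → ℕ)
    {k : ℕ → A} (hk : ∀ i, ∃ j, φ (k i) = .num j) :
    Nonempty (modelStr τ (treeData φ l z d g n G rk) k →[τ.lang] pathStr.{u} τ n) := by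
  let f : A → ULift.{u} (Fin (n + 1)) := fun a => ⟨⟨min (pathPos (φ a)) n, by omega⟩⟩
  refine ⟨⟨f, ?_, ?_⟩⟩
  · rintro _ ⟨c, hc⟩ x
    change f ((treeData φ l z d g n G rk).const k c) = ⟨if c = 2 then Fin.last n else 0⟩
    refine ULift.ext _ _ (Fin.ext ?_)
    rcases c with _ | _ | _ | i
    · change min (pathPos (φ l)) n = 0
      rw [hl, show Tr.leaf = .num 0 from rfl, pathPos_num, Nat.zero_min]
    · change min (pathPos (φ z)) n = 0
      rw [hz, pathPos_pathElt, Nat.zero_min]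
    · change min (pathPos (φ d)) n = n
      rw [hd, pathPos_pathElt, min_self]
    · obtain ⟨j, hj⟩ := hk i
      change min (pathPos (φ (k i))) n = _
      rw [hj, pathPos_num, Nat.zero_min, if_neg (by omega)]
      rfl
  · intro r ⟨P, hP⟩ (x : Fin r → A) hx hP2 a b hab
    obtain rfl : P = 2 := hP2
    replace hab : List.ofFn (f ∘ x) = [a, b] := hab
    have hx' : (treeData φ l z d g n G rk).pred 2 (List.ofFn x) := hx
    rw [← List.map_ofFn] at hab
    match e : List.ofFn x, hx', hab with
    | [x, y], ⟨i, hi, hx, hy⟩, hab =>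
      simp only [List.map_cons, List.map_nil, List.cons.injEq, and_true] at hab
      obtain ⟨rfl, rfl⟩ := hab
      change min (pathPos (φ y)) n = min (pathPos (φ x)) n + 1
      rw [hx, hy, pathPos_pathElt, pathPos_pathElt]
      omega

/-! ### The homomorphism closures -/

section Closure

variable {rs : List Rule} {Ψ : baseSig.lang.Sentence}

theorem foModels_paramSentence_of_ev
    (hΨ : ∀ A : Str.{u} baseSig, A ⊨ Ψ ↔ InfAx rs A.data) (σ : Signature) {m : ℕ}
    (h : Ev rs (.num (m + 1))) : foModels.{u} (paramSentence σ Ψ m) = ∅ := by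
  refine Set.eq_empty_of_forall_notMem fun A hA => ?_
  obtain ⟨k, h1, h2, h3⟩ := exists_chain hA rfl
  exact ((hΨ _).1 ((realize_paramSentence σ Ψ m A).1 hA).2.2).not_ev_of_chain k h1 h2 h3 h

theorem pathStr_mem_homCl_iff
    (hΨ : ∀ A : Str.{u} baseSig, A ⊨ Ψ ↔ InfAx rs A.data) (σ : Signature) {m : ℕ}
    (hm : ¬ Ev rs (.num (m + 1))) (n : ℕ) :
    pathStr.{u} (paramSig σ m) n ∈ homCl (foModels (paramSentence σ Ψ m)) ↔
      ¬ Ev rs (.num (n + 1)) := by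
  constructor
  · rintro ⟨A, hA, ⟨f⟩⟩
    obtain ⟨f, h1, h2, h3⟩ := exists_pathMap (baseSig_le_paramSig σ m) f rfl
    exact ((hΨ _).1 ((realize_paramSentence σ Ψ m A).1 hA).2.2).not_ev_of_path f h1 h2 h3
  · intro hn
    let φ : ULift.{u} Tr → Tr := ULift.down
    have hφ : Function.Bijective φ := ULift.down_bijective
    let k : ℕ → ULift.{u} Tr := fun i => ⟨.num (m + 1 - i)⟩
    refine ⟨modelStr _ (treeData φ ⟨.leaf⟩ ⟨pathElt 0⟩ ⟨pathElt n⟩ ⟨.num (m + 1)⟩ n (Ev rs)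
      fun _ => 0) k, ?_, nonempty_hom_pathStr (φ := φ) _ rfl rfl rfl _ _ fun i => ⟨_, rfl⟩⟩
    refine modelStr_realize (X := fun {A} D => InfAx rs D) rfl ?_ (fun i hi => ?_) hΨ
      (infAx_treeData hφ rfl rfl rfl rfl hm hn)
    · change (⟨.num (m + 1 - (m + 1))⟩ : ULift Tr) = ⟨.leaf⟩
      rw [Nat.sub_self]; rfl
    · change Tr.num (m + 1 - i) = Tr.num (m + 1 - (i + 1) + 1)
      congr 1; omega

theorem finPart_foModels_paramSentence_of_not_ev
    (hΨ : ∀ A : Str.{u} baseSig, A ⊨ Ψ ↔ FinAx rs A.data) (σ : Signature) {m : ℕ}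
    (h : ¬ Ev rs (.num (m + 1))) : finPart (foModels.{u} (paramSentence σ Ψ m)) = ∅ := by
  refine Set.eq_empty_of_forall_notMem fun A hA => h ?_
  obtain ⟨k, h1, h2, h3⟩ := exists_chain hA.1 rfl
  have : Finite (A.reduct (baseSig_le_paramSig σ m)) := hA.2
  exact ((hΨ _).1 ((realize_paramSentence σ Ψ m A).1 hA.1).2.2).ev_of_chain k h1 h2 h3

theorem pathStr_mem_homClFin_iff
    (hΨ : ∀ A : Str.{u} baseSig, A ⊨ Ψ ↔ FinAx rs A.data) (σ : Signature) {m : ℕ}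
    (hm : Ev rs (.num (m + 1))) (n : ℕ) :
    pathStr.{u} (paramSig σ m) n ∈ homClFin (finPart (foModels (paramSentence σ Ψ m))) ↔
      Ev rs (.num (n + 1)) := by
  constructor
  · rintro ⟨⟨A, hA, ⟨f⟩⟩, -⟩
    obtain ⟨f, h1, h2, h3⟩ := exists_pathMap (baseSig_le_paramSig σ m) f rfl
    have : Finite (A.reduct (baseSig_le_paramSig σ m)) := hA.2
    exact ((hΨ _).1 ((realize_paramSentence σ Ψ m A).1 hA.1).2.2).ev_of_path f h1 h2
      fun x y h => (h3 x y h).1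
  · intro hn
    obtain ⟨N₁, h₁⟩ := exists_evB hm
    obtain ⟨N₂, h₂⟩ := exists_evB hn
    obtain ⟨N, hN⟩ : ∃ N, N = N₁ + N₂ + m + n + 4 := ⟨_, rfl⟩
    let A : Type u := ULift.{u} {t : Tr // t.size ≤ N}
    let φ : A → Tr := fun a => a.down.1
    have hφ : Function.Injective φ := Subtype.val_injective.comp ULift.down_injective
    have hA : ∀ t, (∃ a, φ a = t) ↔ t.size ≤ N :=
      fun t => ⟨fun ⟨a, h⟩ => h ▸ a.down.2, fun h => ⟨⟨⟨t, h⟩⟩, rfl⟩⟩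
    have hfin : Finite A := by
      have : Finite {t : Tr // t.size ≤ N} := Tr.finite_size_le N
      infer_instance
    obtain ⟨l, hl⟩ := (hA .leaf).2 (by simp only [Tr.size]; omega)
    obtain ⟨z, hz⟩ := (hA (pathElt 0)).2 (by simp only [pathElt, Tr.size, Tr.size_num]; omega)
    obtain ⟨d, hd⟩ := (hA (pathElt n)).2 (by simp only [pathElt, Tr.size, Tr.size_num]; omega)
    have hk : ∀ i, ∃ a, φ a = .num (m + 1 - i) :=
      fun i => (hA _).2 (by simp only [Tr.size_num]; omega)
    choose k hk using hk
    refine ⟨⟨modelStr _ (treeData φ l z d (k 0) n (fun t => ∃ k, EvB rs N k t)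
      fun t => sInf {k | EvB rs N k t}) k, ⟨?_, hfin⟩,
      nonempty_hom_pathStr _ hl hz hd _ _ fun i => ⟨_, hk i⟩⟩, ?_⟩
    · refine modelStr_realize (X := fun {A} D => FinAx rs D) rfl ?_ (fun i hi => ?_) hΨ
        (finAx_treeData hφ hA hl hz hd (hk 0) (h₁.mono (k' := N) (by omega) (by omega))
          (h₂.mono (by omega) (by omega)) (by omega))
      · exact hφ ((hk _).trans (by rw [Nat.sub_self]; exact hl.symm))
      · change φ (k i) = .node (φ l) (φ (k (i + 1)))
        rw [hk, hk, hl, show m + 1 - i = m + 1 - (i + 1) + 1 by omega]; rfl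
    · exact inferInstanceAs (Finite (ULift (Fin (n + 1))))

end Closure

/-! ### Codes of the structures -/

/-- The tuples of length `k` over `{0, …, n}`. -/
def tuples (n : ℕ) : ℕ → List (List ℕ)
  | 0 => [([] : List ℕ)]
  | k + 1 => (tuples n k).flatMap fun l => (List.range (n + 1)).map fun x => x :: l

theorem mem_tuples {n k : ℕ} {l : List ℕ} : l ∈ tuples n k ↔ l.length = k ∧ ∀ x ∈ l, x < n + 1 := by
  induction k generalizing l with
  | zero =>
    simp only [tuples, List.mem_singleton, List.length_eq_zero_iff]
    exact ⟨fun h => ⟨h, by simp [h]⟩, And.left⟩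
  | succ k ih =>
    simp only [tuples, List.mem_flatMap, List.mem_map, List.mem_range, ih]
    constructor
    · rintro ⟨l, ⟨h1, h2⟩, x, hx, rfl⟩
      exact ⟨by simp [h1], List.forall_mem_cons.2 ⟨hx, h2⟩⟩
    · rintro ⟨h1, h2⟩
      cases l with
      | nil => cases h1
      | cons x l =>
        exact ⟨l, ⟨Nat.succ.inj h1, fun y hy => h2 y (List.mem_cons_of_mem _ hy)⟩, x,
          h2 x List.mem_cons_self, rfl⟩

open Primrec in
theorem primrec_tuples (k : ℕ) : Primrec fun n => tuples n k := by
  induction k with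
  | zero => exact const _
  | succ k ih =>
    have h : Primrec₂ fun (p : ℕ × List ℕ) (x : ℕ) => x :: p.2 :=
      list_cons.comp snd (snd.comp fst)
    have h' : Primrec₂ fun (n : ℕ) (l : List ℕ) => (List.range (n + 1)).map fun x => x :: l :=
      list_map (list_range.comp (succ.comp fst)) h
    exact list_flatMap ih h'

/-- The code of the interpretation of a predicate symbol in `pathStr`. -/
def pathRelCode (p : ℕ × ℕ) (n : ℕ) : List (ℕ × List ℕ) :=
  if p = (2, 2) then (List.range n).map fun i => (2, [i, i + 1])
  else (tuples n p.2).map fun l => (p.1, l)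

theorem primrec_pathRelCode (p : ℕ × ℕ) : Primrec (pathRelCode p) := by
  unfold pathRelCode
  split_ifs
  · exact Primrec.list_map Primrec.list_range (Primrec.pair (Primrec.const 2) (Primrec.list_cons.comp
      Primrec.snd (Primrec.list_cons.comp (Primrec.succ.comp Primrec.snd) (Primrec.const []))))
  · exact Primrec.list_map (primrec_tuples _) (Primrec.pair (Primrec.const _) Primrec.snd)

theorem mem_pathRelCode {p : ℕ × ℕ} {n P : ℕ} {l : List ℕ} : (P, l) ∈ pathRelCode p n ↔
    P = p.1 ∧ l.length = p.2 ∧ (∀ x ∈ l, x < n + 1) ∧ (P = 2 → ∀ x y, l = [x, y] → y = x + 1) := by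
  unfold pathRelCode
  split_ifs with hp
  · subst hp
    simp only [List.mem_map, List.mem_range, Prod.mk.injEq]
    constructor
    · rintro ⟨i, hi, rfl, rfl⟩
      refine ⟨rfl, rfl, ?_, ?_⟩
      · simp only [List.mem_cons, List.not_mem_nil, or_false, forall_eq_or_imp, forall_eq]
        omega
      · rintro - x y h
        simp only [List.cons.injEq, and_true] at h
        omega
    · rintro ⟨rfl, h1, h2, h3⟩
      obtain ⟨x, y, rfl⟩ := List.length_eq_two.1 h1
      obtain rfl := h3 rfl x y rfl
      exact ⟨x, Nat.lt_of_succ_lt_succ (h2 (x + 1) (by simp)), rfl, rfl⟩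
  · simp only [List.mem_map, mem_tuples, Prod.mk.injEq]
    constructor
    · rintro ⟨l, ⟨h1, h2⟩, rfl, rfl⟩
      refine ⟨rfl, h1, h2, ?_⟩
      rintro h x y rfl
      exact absurd (Prod.ext h h1.symm) hp
    · rintro ⟨rfl, h1, h2, -⟩
      exact ⟨l, ⟨h1, h2⟩, rfl, rfl⟩

/-- The code of `pathStr`. -/
def pathCode (w : SigCode) (n : ℕ) : StrCode :=
  (w, n + 1, w.1.map fun c => (c, if c = 2 then n else 0), w.2.flatMap fun p => pathRelCode p n)

theorem primrec_pathCode (w : SigCode) : Primrec (pathCode w) := by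
  have h1 : ∀ l : List ℕ, Primrec fun n : ℕ => l.map fun c => (c, if c = 2 then n else 0) := by
    intro l
    induction l with
    | nil => exact Primrec.const _
    | cons c l ih =>
      refine Primrec.list_cons.comp (Primrec.pair (Primrec.const c) ?_) ih
      split_ifs
      · exact Primrec.id
      · exact Primrec.const 0
  have h2 : ∀ l : List (ℕ × ℕ), Primrec fun n : ℕ => l.flatMap fun p => pathRelCode p n := by
    intro l
    induction l with
    | nil => exact Primrec.const _
    | cons p l ih => exact Primrec.list_append.comp (primrec_pathRelCode p) ih
  exact (Primrec.const w).pair (Primrec.succ.pair ((h1 _).pair (h2 _)))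

theorem codesStr_pathCode {w : SigCode} {τ : Signature} (hw : CodesSig w τ) (n : ℕ) :
    CodesStr (pathCode w n) (pathStr.{u} τ n) := by
  refine ⟨hw, Equiv.ulift, fun c m => ?_, fun P l => ?_⟩
  · change (c, m) ∈ w.1.map (fun c => (c, if c = 2 then n else 0)) ↔
      ∃ _ : c ∈ τ.consts, m = ((if c = 2 then Fin.last n else 0 : Fin (n + 1)) : ℕ)
    have e (c : ℕ) : ((if c = 2 then Fin.last n else 0 : Fin (n + 1)) : ℕ) =
        if c = 2 then n else 0 := by
      split_ifs <;> rfl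
    simp only [List.mem_map, Prod.mk.injEq, hw.1, e, exists_prop]
    constructor
    · rintro ⟨c, hc, rfl, rfl⟩
      exact ⟨hc, rfl⟩
    · rintro ⟨hc, rfl⟩
      exact ⟨c, hc, rfl, rfl⟩
  · change (P, l) ∈ w.2.flatMap (fun p => pathRelCode p n) ↔
      ∃ (k : ℕ) (_ : (P, k) ∈ τ.preds) (a : Fin k → ULift.{u} (Fin (n + 1))),
        (P = 2 → ∀ x y, List.ofFn a = [x, y] → (y.down : ℕ) = x.down + 1) ∧
        l = List.ofFn fun i => ((a i).down : ℕ)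
    simp only [List.mem_flatMap, mem_pathRelCode, hw.2]
    constructor
    · rintro ⟨⟨P, k⟩, hP, rfl, rfl, h1, h2⟩
      refine ⟨_, hP, fun i => ⟨⟨l.get i, h1 _ (List.get_mem _ _)⟩⟩, fun h x y e => ?_,
        (List.ofFn_get l).symm⟩
      refine h2 h _ _ ?_
      have := congrArg (List.map fun x : ULift.{u} (Fin (n + 1)) => (x.down : ℕ)) e
      rw [List.map_ofFn] at this
      exact (List.ofFn_get l).symm.trans this
    · rintro ⟨k, hP, a, h, rfl⟩
      refine ⟨(P, k), hP, rfl, List.length_ofFn, fun x hx => ?_, fun h2 x y e => ?_⟩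
      · obtain ⟨i, rfl⟩ := (List.mem_ofFn' _ _).1 hx
        exact (a i).down.isLt
      · obtain rfl : k = 2 := by simpa using congrArg List.length e
        simp only [List.ofFn_succ, List.ofFn_zero, List.cons.injEq, and_true] at e
        obtain ⟨rfl, rfl⟩ := e
        exact h h2 _ _ (by simp only [List.ofFn_succ, List.ofFn_zero])

/-! ### Undecidability -/

theorem IsDecidableProblem.computablePred {α : Type} [Primcodable α] {ι : Type*}
    {Codes : α → ι → Prop} {Yes : ι → Prop} (h : IsDecidableProblem Codes Yes) {w : ℕ → α}
    (hw : Computable w) {i : ℕ → ι} (hi : ∀ n, Codes (w n) (i n)) :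
    ComputablePred fun n => Yes (i n) := by
  classical
  obtain ⟨f, hf, H⟩ := h
  refine ⟨fun n => Classical.dec _, (hf.comp hw).of_eq fun n => ?_⟩
  refine Part.eq_some_iff.2 ?_
  change decide (Yes (i n)) ∈ f (w n)
  by_cases hy : Yes (i n)
  · rw [decide_eq_true hy]
    exact (H _ _ (hi n)).1 hy
  · rw [decide_eq_false hy]
    exact (H _ _ (hi n)).2 hy

/-- The code of `paramSig`. -/
noncomputable def paramSigCode (σ : Signature) (m : ℕ) : SigCode :=
  (σ.consts.toList ++ List.range (m + 5), (σ.preds ∪ baseSig.preds).toList)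

theorem codesSig_paramSigCode (σ : Signature) (m : ℕ) :
    CodesSig (paramSigCode σ m) (paramSig σ m) :=
  ⟨fun c => by simp [paramSigCode, paramSig], fun p => by simp [paramSigCode, paramSig]⟩

/-- The parametrized sentences as inputs. -/
def paramInput (σ : Signature) (Ψ : baseSig.lang.Sentence) (m : ℕ) : FOInput :=
  ⟨paramSig σ m, paramSentence σ Ψ m⟩

/-- If the problem `Yes` is decidable, then so is `p`, provided that `Yes` asks for a description of
classes `Cl m` that are empty if `p m` fails, and that encode `p` otherwise. -/
theorem computablePred_of_isDecidableProblem (L : Logic.{u}) (hMC : L.DecidableModelChecking)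
    {σ : Signature} {ψ₀ : ℕ} (hψ₀ : ψ₀ ∈ L.Sentence σ) (hσ : L.models σ ψ₀ = ∅)
    (Ψ : baseSig.lang.Sentence) {Yes : FOInput → Prop} (hYes : IsDecidableProblem CodesFOInput Yes)
    (Cl : ∀ m, Set (Str.{u} (paramSig σ m)))
    (yes_of : ∀ m, ∀ ψ ∈ L.Sentence (paramSig σ m), L.models (paramSig σ m) ψ = ∅ → Cl m = ∅ →
      Yes (paramInput σ Ψ m))
    (of_yes : ∀ m, Yes (paramInput σ Ψ m) → ∃ ψ ∈ L.Sentence (paramSig σ m),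
      ∀ n, L.Sat (pathStr.{u} (paramSig σ m) n) ψ ↔ pathStr.{u} (paramSig σ m) n ∈ Cl m)
    {p : ℕ → Prop} (h_empty : ∀ m, ¬ p m → Cl m = ∅)
    (h_mem : ∀ m, p m → ∀ n, pathStr.{u} (paramSig σ m) n ∈ Cl m ↔ p n) : ComputablePred p := by
  by_contra hp
  have key : ∀ m, Yes (paramInput σ Ψ m) ↔ ¬ p m := by
    refine fun m => ⟨fun hy hm => hp ?_, fun hm => ?_⟩
    · obtain ⟨ψ, hψ, H⟩ := of_yes m hy
      have hw : Computable fun n => (ψ, pathCode (paramSigCode σ m) n) :=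
        (Computable.const ψ).pair (primrec_pathCode _).to_comp
      refine (IsDecidableProblem.computablePred hMC hw (i := fun n => ⟨paramSig σ m, ψ, hψ,
        pathStr.{u} (paramSig σ m) n, inferInstanceAs (Finite (ULift (Fin (n + 1))))⟩)
        fun n => ⟨rfl, codesStr_pathCode (codesSig_paramSigCode σ m) n⟩).of_eq fun n => ?_
      exact (H n).trans (h_mem m hm n)
    · refine yes_of m ψ₀ (L.sentence_mono (le_paramSig σ m) hψ₀) ?_ (h_empty m hm)
      refine Set.eq_empty_of_forall_notMem fun A hA => ?_
      have : A.reduct (le_paramSig σ m) ∈ L.models σ ψ₀ :=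
        (L.sat_reduct (le_paramSig σ m) A ψ₀ hψ₀).1 hA
      rw [hσ] at this
      exact this
  have hw : Computable fun m => (paramSigCode σ m, paramCode (formulaCode Ψ) m) := by
    refine Primrec.to_comp (Primrec.pair (Primrec.pair ?_ (Primrec.const _)) (primrec_paramCode _))
    exact Primrec.list_append.comp (Primrec.const _)
      (Primrec.list_range.comp (Primrec.nat_add.comp .id (Primrec.const 5)))
  have h := hYes.computablePred hw (i := paramInput σ Ψ) fun m =>
    ⟨codesSig_paramSigCode σ m, (formulaCode_paramSentence σ Ψ m).symm⟩
  exact hp (h.not.of_eq fun m => by rw [key, not_not])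

end HomClosure

theorem mainTheorem11 (L : HomClosure.Logic.{u}) (hL : L.NonDegenerate)
    (hMC : L.DecidableModelChecking) :
    ¬ HomClosure.IsDecidableProblem HomClosure.CodesFOInput (HomClosure.ExCharHomCl L) ∧
    ¬ HomClosure.IsDecidableProblem HomClosure.CodesFOInput (HomClosure.ExCharHomClFin L) := by
  open HomClosure in
  obtain ⟨σ, ψ₀, hψ₀, hσ⟩ := hL
  obtain ⟨rs, hrs⟩ := exists_rules_undecidable
  constructor
  · intro hYes
    obtain ⟨Ψ, hΨ⟩ := exists_sentence_infAx.{u} rs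
    have h := computablePred_of_isDecidableProblem L hMC hψ₀ hσ Ψ hYes
      (Cl := fun m => homCl (foModels (paramSentence σ Ψ m)))
      (p := fun m => ¬ Ev rs (.num (m + 1)))
      (fun m ψ hψ h h' => ⟨ψ, hψ, h.trans h'.symm⟩)
      (fun m ⟨ψ, hψ, h⟩ => ⟨ψ, hψ, fun n => iff_of_eq (congrArg (pathStr _ n ∈ ·) h)⟩)
      (fun m hm => by
        rw [foModels_paramSentence_of_ev hΨ σ (not_not.1 hm)]
        simp [homCl])
      (fun m hm n => pathStr_mem_homCl_iff hΨ σ hm n)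
    exact hrs (h.not.of_eq fun m => not_not)
  · intro hYes
    obtain ⟨Ψ, hΨ⟩ := exists_sentence_finAx.{u} rs
    refine hrs (computablePred_of_isDecidableProblem L hMC hψ₀ hσ Ψ hYes
      (Cl := fun m => homClFin (finPart (foModels (paramSentence σ Ψ m))))
      (p := fun m => Ev rs (.num (m + 1)))
      (fun m ψ hψ h h' => ⟨ψ, hψ, ?_⟩)
      (fun m ⟨ψ, hψ, h⟩ => ⟨ψ, hψ, fun n => ?_⟩)
      (fun m hm => ?_)
      (fun m hm n => pathStr_mem_homClFin_iff hΨ σ hm n))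
    · refine Eq.trans ?_ h'.symm
      refine Set.eq_empty_of_forall_notMem fun A hA => ?_
      have hA' : A ∈ L.models (paramSig σ m) ψ := hA.1
      rw [h] at hA'
      exact hA'
    · refine Iff.trans ?_ (iff_of_eq (congrArg (pathStr _ n ∈ ·) h))
      exact ⟨fun h => ⟨h, inferInstanceAs (Finite (ULift (Fin (n + 1))))⟩, And.left⟩
    · rw [finPart_foModels_paramSentence_of_not_ev hΨ σ hm]
      simp [homClFin, finPart, homCl]
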